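/- Let $\Sigma$ be an alphabet, $\bar\Sigma=\Sigma\cup\{\varepsilon\}$, where $\varepsilon$ is the empty string. A \emph{forest} over $\Sigma$ is a balanced string of labeled parentheses, i.e., an element of the smallest set of strings over $\{(_a,\,)_a : a\in\Sigma\}$ that contains the empty string and is closed under $F,G\mapsto F\cdot G$ and $F\mapsto (_a\cdot F\cdot )_a$ for $a\in\Sigma$. $|F|$ is the length of $F$ as a string, $F[i..j)$ denotes the fragment $F[i]\cdots F[j-1]$, and $P$ \emph{occurs in $F$ at position $p$} if $P=F[p..p+|P|)$. A \emph{node} of $F$ is a pair $u=(o(u),c(u))$ of positions carrying an opening parenthesis and its matching closing parenthesis. An \emph{alignment} of $F$ onto $G$ is a sequence $(x_t,y_t)_{t=0}^m$ with $(x_0,y_0)=(0,0)$, $(x_m,y_m)=(|F|,|G|)$, and $(x_{t+1},y_{t+1})\in\{(x_t+1,y_t+1),(x_t+1,y_t),(x_t,y_t+1)\}$ for $0\le t<m$; these three kinds of steps align $F[x_t]$ to $G[y_t]$, delete $F[x_t]$, and insert $G[y_t]$, respectively. It is a \emph{forest alignment} if for every node $u$ of $F$ either both $F[o(u)]$ and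 $F[c(u)]$ are deleted, or there is a node $v$ of $G$ such that $F[o(u)]$ is aligned to $G[o(v)]$ and $F[c(u)]$ is aligned to $G[c(v)]$. A \emph{normalized quasimetric} is a function $w:\bar\Sigma\times\bar\Sigma\to\mathbb{R}_{\ge0}\cup\{\infty\}$ such that $w(a,a)=0$, $w(a,c)\le w(a,b)+w(b,c)$ for all $a,b,c\in\bar\Sigma$, and $w(a,b)\ge1$ whenever $a\ne b$. The cost of a forest alignment is one half of the sum of the costs of its steps, where aligning a parenthesis with label $a$ to one with label $b$ costs $w(a,b)$, deleting a parenthesis with label $a$ costs $w(a,\varepsilon)$, and inserting one with label $b$ costs $w(\varepsilon,b)$. Let $\mathsf{ted}^w(F,G)$ be the minimum cost of a forest alignment of $F$ onto $G$, and let $\mathsf{ted}^w_{\le k}(F,G)$ equal $\mathsf{ted}^w(F,G)$ if this is at most $k$, and $\infty$ otherwise. Forests $P,P'$ are \emph{$\mathsf{ted}^w_{\le k}$-equivalent} if $$\mathsf{ted}^w_{\le k}(F,G)=\mathsf{ted}^w_{\le k}\bigl(F[0..p_F)\cdot P'\cdot F[p_F+|P|..|F|),\; G[0..p_G)\cdot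 P'\cdot G[p_G+|P|..|G|)\bigr)$$ holds for all forests $F$ and $G$ in which $P$ occurs at positions $p_F$ and $p_G$, respectively, with $|p_F-p_G|\le 2k$. A forest $F$ \emph{avoids horizontal $k$-periodicity} if there is no forest $Q$ with $1\le|Q|\le 4k$ such that $Q^{4k+1}$ (the concatenation of $4k+1$ copies of $Q$) occurs in $F$. \textbf{Lemma.} Let $k\ge1$ be an integer and let $P,P'$ be forests of length $|P|,|P'|\ge 74k^3$ avoiding horizontal $k$-periodicity. Then $P$ and $P'$ are $\mathsf{ted}^w_{\le k}$-equivalent for every normalized quasimetric $w$. -/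

import Mathlib

open scoped ENNReal NNReal

namespace TreeEdit

/-! Parentheses and forests -/

/-- Parentheses with labels over the alphabet `σ`. -/
inductive Paren (σ : Type*) where
  | opening (a : σ) : Paren σ
  | closing (a : σ) : Paren σ

/-- The label of a parenthesis. -/
def Paren.label {σ : Type*} : Paren σ → σ
  | .opening a => a
  | .closing a => a

/-- Forests with node labels over `σ`: the smallest set of strings of parentheses that contains the
empty string and is closed under concatenation and under enclosing in a pair of parentheses with
equal labels. -/
inductive IsForest {σ : Type*} : List (Paren σ) → Prop
  | nil : IsForest []
  | append {F G : List (Paren σ)} : IsForest F → IsForest G → IsForest (F ++ G)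
  | enclose (a : σ) {F : List (Paren σ)} :
      IsForest F → IsForest (Paren.opening a :: (F ++ [Paren.closing a]))

/-- `frag X i j` is the fragment `X[i .. j)` of the string `X` (used for `i ≤ j ≤ |X|`). -/
def frag {α : Type*} (X : List α) (i j : ℕ) : List α := (X.drop i).take (j - i)

/-- `P` occurs in `X` at position `p`, that is, `P = X[p .. p + |P|)`. -/
def OccursAt {α : Type*} (P X : List α) (p : ℕ) : Prop :=
  p + P.length ≤ X.length ∧ frag X p (p + P.length) = P

/-- `pow Q m` is the concatenation of `m` copies of `Q`. -/
def pow {α : Type*} (Q : List α) (m : ℕ) : List α := (List.replicate m Q).flatten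

/-- `IsNode F i j`: the positions `i` and `j` carry the opening and the closing parenthesis of one
node of the forest `F`, that is, they carry parentheses matching each other. -/
def IsNode {σ : Type*} (F : List (Paren σ)) (i j : ℕ) : Prop :=
  i < j ∧ (∃ a : σ, F[i]? = some (Paren.opening a) ∧ F[j]? = some (Paren.closing a)) ∧
    IsForest (frag F (i + 1) j)

/-- `F` avoids horizontal `k`-periodicity: there is no forest `Q` of length in `[1 .. 4k]` such that
`Q ^ (4k+1)` occurs in `F`. -/
def AvoidsHorizontalPeriodicity {σ : Type*} (k : ℕ) (F : List (Paren σ)) : Prop :=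
  ¬ ∃ Q : List (Paren σ), IsForest Q ∧ 1 ≤ Q.length ∧ Q.length ≤ 4 * k ∧
    ∃ p : ℕ, OccursAt (pow Q (4 * k + 1)) F p

/-! Alignments -/

/-- An alignment `(x t, y t)`, `0 ≤ t ≤ m`, of the string `X` onto the string `Y`. The values of the
functions `x` and `y` beyond `m` play no role. -/
structure Alignment {α β : Type*} (X : List α) (Y : List β) where
  m : ℕ
  x : ℕ → ℕ
  y : ℕ → ℕ
  x_zero : x 0 = 0
  y_zero : y 0 = 0
  x_last : x m = X.length
  y_last : y m = Y.length
  step : ∀ t < m, (x (t + 1) = x t + 1 ∧ y (t + 1) = y t + 1) ∨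
    (x (t + 1) = x t + 1 ∧ y (t + 1) = y t) ∨ (x (t + 1) = x t ∧ y (t + 1) = y t + 1)

namespace Alignment

variable {α : Type*} {X Y : List α}

/-- The alignment deletes `X[i]`. -/
def Deletes (A : Alignment X Y) (i : ℕ) : Prop :=
  ∃ t < A.m, A.x t = i ∧ A.x (t + 1) = i + 1 ∧ A.y (t + 1) = A.y t

/-- The alignment aligns `X[i]` to `Y[j]`. -/
def Aligns (A : Alignment X Y) (i j : ℕ) : Prop :=
  ∃ t < A.m, A.x t = i ∧ A.y t = j ∧ A.x (t + 1) = i + 1 ∧ A.y (t + 1) = j + 1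

/-- The cost of step `t` of an alignment; `none` stands for the empty string `ε`. Aligning two equal
characters contributes `w a a`, which is zero for every weight function. -/
def stepCost (w : Option α → Option α → ℝ≥0∞) (A : Alignment X Y) (t : ℕ) : ℝ≥0∞ :=
  if A.y (t + 1) = A.y t then w X[A.x t]? none
  else if A.x (t + 1) = A.x t then w none Y[A.y t]?
  else w X[A.x t]? Y[A.y t]?

/-- The cost of an alignment: the total cost of its edits. -/
noncomputable def cost (w : Option α → Option α → ℝ≥0∞) (A : Alignment X Y) : ℝ≥0∞ :=
  ∑ t ∈ Finset.range A.m, A.stepCost w t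

end Alignment

/-- The consistency conditions that make an alignment of two forests a forest alignment. -/
def Alignment.IsForestAlignment {σ : Type*} {F G : List (Paren σ)} (A : Alignment F G) : Prop :=
  ∀ o c : ℕ, IsNode F o c →
    (A.Deletes o ∧ A.Deletes c) ∨
    ∃ o' c' : ℕ, IsNode G o' c' ∧ A.Aligns o o' ∧ A.Aligns c c'

/-! Weight functions and tree edit distance; `none : Option σ` stands for `ε` -/

/-- `w` is a weight function satisfying the triangle inequality. -/
structure IsQuasimetric {σ : Type*} (w : Option σ → Option σ → ℝ≥0∞) : Prop where
  self_eq_zero : ∀ a, w a a = 0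
  triangle : ∀ a b c, w a c ≤ w a b + w b c

/-- `w` is normalized: distinct arguments have weight at least one. -/
def IsNormalized {σ : Type*} (w : Option σ → Option σ → ℝ≥0∞) : Prop :=
  ∀ a b, a ≠ b → 1 ≤ w a b

/-- The weight function on parentheses (and `ε`) induced by a weight function on labels. -/
def parenWeight {σ : Type*} (w : Option σ → Option σ → ℝ≥0∞)
    (p q : Option (Paren σ)) : ℝ≥0∞ :=
  w (p.map Paren.label) (q.map Paren.label)

/-- The cost of a forest alignment: half of its cost as an alignment of strings of parentheses. -/
noncomputable def tedCost {σ : Type*} (w : Option σ → Option σ → ℝ≥0∞)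
    {F G : List (Paren σ)} (A : Alignment F G) : ℝ≥0∞ :=
  A.cost (parenWeight w) / 2

/-- The weighted tree edit distance: the smallest cost of a forest alignment of `F` onto `G`. The
infimum is a minimum, see `exists_tedCost_eq_ted`. -/
noncomputable def ted {σ : Type*} (w : Option σ → Option σ → ℝ≥0∞)
    (F G : List (Paren σ)) : ℝ≥0∞ :=
  ⨅ A : {A : Alignment F G // A.IsForestAlignment}, tedCost w A.1

open Classical in
/-- The tree edit distance capped at the threshold `k`: values above `k` are replaced by `∞`. -/
noncomputable def tedLE {σ : Type*} (k : ℝ≥0) (w : Option σ → Option σ → ℝ≥0∞)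
    (F G : List (Paren σ)) : ℝ≥0∞ :=
  if ted w F G ≤ (k : ℝ≥0∞) then ted w F G else ⊤

/-- The string obtained from `X` by replacing the fragment `X[p .. p + ℓ)` with `P'`. -/
def replaceFrag {α : Type*} (X : List α) (p ℓ : ℕ) (P' : List α) : List α :=
  frag X 0 p ++ P' ++ frag X (p + ℓ) X.length

/-- The forests `P` and `P'` are equivalent with respect to the tree edit distance with weight `w`
and threshold `k`. -/
def TedEquivalent {σ : Type*} (k : ℕ) (w : Option σ → Option σ → ℝ≥0∞)
    (P P' : List (Paren σ)) : Prop :=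
  ∀ (F G : List (Paren σ)) (pF pG : ℕ), IsForest F → IsForest G →
    OccursAt P F pF → OccursAt P G pG → |(pF : ℤ) - (pG : ℤ)| ≤ 2 * (k : ℤ) →
    tedLE (k : ℝ≥0) w F G =
      tedLE (k : ℝ≥0) w (replaceFrag F pF P.length P') (replaceFrag G pG P.length P')

/-! The minimum in the definition of `ted` exists -/

theorem Alignment.bounds {α β : Type*} {X : List α} {Y : List β} (A : Alignment X Y) :
    (∀ t ≤ A.m, t ≤ A.x t + A.y t) ∧ ∀ t ≤ A.m, A.x t ≤ X.length ∧ A.y t ≤ Y.length := by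
  constructor
  · intro t
    induction t with
    | zero => intro _; omega
    | succ t ih =>
      intro h
      have h1 := ih (by omega)
      have h2 := A.step t (by omega)
      omega
  · have key : ∀ d t, t + d = A.m → A.x t ≤ X.length ∧ A.y t ≤ Y.length := by
      intro d
      induction d with
      | zero =>
        intro t h
        have h : t = A.m := by omega
        subst h
        exact ⟨A.x_last.le, A.y_last.le⟩
      | succ d ih =>
        intro t h
        have h1 := ih (t + 1) (by omega)
        have h2 := A.step t (by omega)
        omega
    intro t h
    exact key (A.m - t) t (by omega)

/-- Deleting all of `F` and then inserting all of `G` is an alignment. -/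
def Alignment.trivial {α β : Type*} (X : List α) (Y : List β) : Alignment X Y where
  m := X.length + Y.length
  x t := min t X.length
  y t := t - X.length
  x_zero := by simp
  y_zero := by simp
  x_last := by simp
  y_last := by simp
  step := by intro t _; omega

theorem Alignment.trivial_isForestAlignment {σ : Type*} (F G : List (Paren σ)) :
    (Alignment.trivial F G).IsForestAlignment := by
  have del : ∀ i < F.length, (Alignment.trivial F G).Deletes i := by
    intro i hi
    refine ⟨i, ?_, ?_, ?_, ?_⟩ <;> simp only [Alignment.trivial] <;> omega
  rintro o c ⟨hoc, ⟨a, -, hc⟩, -⟩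
  have hc' : c < F.length := (List.getElem?_eq_some_iff.mp hc).1
  exact Or.inl ⟨del o (by omega), del c hc'⟩

theorem exists_tedCost_eq_ted {σ : Type*} (w : Option σ → Option σ → ℝ≥0∞)
    (F G : List (Paren σ)) :
    ∃ A : Alignment F G, A.IsForestAlignment ∧ tedCost w A = ted w F G := by
  classical
  let v := parenWeight w
  let S : Set ℝ≥0∞ := (fun p : ℕ × ℕ => v F[p.1]? none) ''
      (Set.Iic F.length ×ˢ Set.Iic G.length) ∪
    (fun p : ℕ × ℕ => v none G[p.2]?) '' (Set.Iic F.length ×ˢ Set.Iic G.length) ∪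
    (fun p : ℕ × ℕ => v F[p.1]? G[p.2]?) '' (Set.Iic F.length ×ˢ Set.Iic G.length)
  have hI : (Set.Iic F.length ×ˢ Set.Iic G.length : Set (ℕ × ℕ)).Finite :=
    (Set.finite_Iic _).prod (Set.finite_Iic _)
  have hS : S.Finite := ((hI.image _).union (hI.image _)).union (hI.image _)
  have : Finite S := hS
  have hfin : (Set.range fun A : {A : Alignment F G // A.IsForestAlignment} =>
      tedCost w A.1).Finite := by
    refine ((List.finite_length_le S (F.length + G.length)).image
      (fun l : List S => (l.map Subtype.val).sum / 2)).subset ?_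
    rintro _ ⟨⟨A, hA⟩, rfl⟩
    have hb := A.bounds
    have hmem : ∀ t < A.m, A.stepCost v t ∈ S := by
      intro t ht
      have ht' := hb.2 t ht.le
      have hp : (A.x t, A.y t) ∈ (Set.Iic F.length ×ˢ Set.Iic G.length : Set (ℕ × ℕ)) := ht'
      unfold Alignment.stepCost
      split_ifs
      · exact Or.inl (Or.inl ⟨_, hp, rfl⟩)
      · exact Or.inl (Or.inr ⟨_, hp, rfl⟩)
      · exact Or.inr ⟨_, hp, rfl⟩
    refine ⟨List.ofFn fun i : Fin A.m => (⟨A.stepCost v i, hmem i i.2⟩ : S), ?_, ?_⟩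
    · have h1 := hb.1 A.m le_rfl
      have h2 := hb.2 A.m le_rfl
      simp only [Set.mem_ofPred_eq, List.length_ofFn]
      omega
    · simp only [tedCost, Alignment.cost, List.map_ofFn, List.sum_ofFn, Function.comp_def]
      rw [Finset.sum_range]
  have hne : (Set.range fun A : {A : Alignment F G // A.IsForestAlignment} =>
      tedCost w A.1).Nonempty :=
    ⟨_, ⟨⟨Alignment.trivial F G, Alignment.trivial_isForestAlignment F G⟩, rfl⟩⟩
  obtain ⟨⟨A, hA⟩, h⟩ := hne.csInf_mem hfin
  exact ⟨A, hA, h⟩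

end TreeEdit

/-! By symmetry it suffices that replacing `P` by `P'` does not increase a distance that is at most
`k` (`ted_replace_le`). Write the forests as `U ++ P ++ V` and `U' ++ P ++ V'` and take an optimal
forest alignment. Its cost as a string alignment is at most `2k`, so it has at most `2k` edits and
the path stays within `2k` of the main diagonal.

The heart is that this path meets the diagonal of the square `P × P`, that is, passes through a
point `(|U| + i, |U'| + i)` (`exists_diagonal_point`). As `P` is long, the path has an edit-free run
of `20k²` steps inside the square. If the run is off the diagonal, by some `0 < s ≤ 4k`, then a long
fragment of `P` has period `s`. Consider the height gained per period. If it is zero, cutting at a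
height minimum exhibits a forest of length `s` repeated `4k + 1` times, which is excluded. If it is
not zero, two parentheses `s` apart belong to nested nodes (`exists_nested_nodes_of_periodic`). The
run aligns these two parentheses, so their mates are aligned as well; by nesting, the mates occur in
the opposite order, hence lie on the other side of the diagonal, and the path must cross it.

Given a diagonal point, view the alignment as a noncrossing matching. Peel the copies of `P` off
both forests, one pair of equal positions at a time, starting from the diagonal point and moving
outwards. The triangle inequality shows that no removal raises the cost (`matchingCost_le_insert`,
`matchingCost_outside_le`). Then insert `P'` on both sides, aligned identically at no cost
(`exists_replace`). -/

namespace TreeEdit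

/-! Heights -/

/-- `1` for opening and `-1` for closing parentheses. -/
def Paren.sign {σ : Type*} : Paren σ → ℤ
  | .opening _ => 1
  | .closing _ => -1

/-- The number of opening parentheses minus the number of closing parentheses. -/
def height {σ : Type*} (F : List (Paren σ)) : ℤ := (F.map Paren.sign).sum

/-- The height of the prefix of length `i`. -/
def prefixHeight {σ : Type*} (F : List (Paren σ)) (i : ℕ) : ℤ := height (F.take i)

section Forests

variable {σ : Type*} {F G P P' U V W : List (Paren σ)}

@[simp] theorem height_nil : height ([] : List (Paren σ)) = 0 := rfl

@[simp] theorem height_append : height (F ++ G) = height F + height G := by simp [height]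

@[simp] theorem height_cons (p : Paren σ) : height (p :: F) = p.sign + height F := by
  simp [height]

theorem IsForest.height_eq_zero (hF : IsForest F) : height F = 0 := by
  induction hF with
  | nil => rfl
  | append _ _ h1 h2 => simp [h1, h2]
  | enclose a _ h => simp [h, Paren.sign]

theorem IsForest.prefixHeight_nonneg (hF : IsForest F) (i : ℕ) : 0 ≤ prefixHeight F i := by
  unfold prefixHeight
  induction hF generalizing i with
  | nil => simp
  | append _ _ h1 h2 =>
    rw [List.take_append, height_append]
    exact add_nonneg (h1 i) (h2 _)
  | @enclose a F hF h =>
    cases i with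
    | zero => simp
    | succ i =>
      rw [List.take_succ_cons, height_cons, List.take_append, height_append]
      have h1 := h i
      have h2 : -1 ≤ height (List.take (i - F.length) [Paren.closing a]) := by
        cases i - F.length <;> simp [Paren.sign]
      simp only [Paren.sign]
      omega

theorem take_append_frag {α : Type*} (X : List α) {i j : ℕ} (hij : i ≤ j) :
    X.take i ++ frag X i j = X.take j := by
  unfold frag
  rw [← List.take_add, Nat.add_sub_cancel' hij]

theorem height_frag {i j : ℕ} (hij : i ≤ j) :
    height (frag F i j) = prefixHeight F j - prefixHeight F i := by
  unfold prefixHeight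
  rw [← take_append_frag F hij, height_append]
  ring

theorem take_frag {α : Type*} (X : List α) {i j m : ℕ} (hij : m ≤ j) :
    (frag X i j).take (m - i) = frag X i m := by
  unfold frag
  rw [List.take_take, min_eq_left (by omega)]

theorem prefixHeight_succ {i : ℕ} {p : Paren σ} (h : F[i]? = some p) :
    prefixHeight F (i + 1) = prefixHeight F i + p.sign := by
  unfold prefixHeight
  rw [List.take_add_one, h]
  simp

/-! Reductions -/

/-- Reading `W` with a stack of labels leads from the stack `s` to the stack `t`. -/
def Reduces : List (Paren σ) → List σ → List σ → Prop
  | [], s, t => s = t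
  | .opening a :: W, s, t => Reduces W (a :: s) t
  | .closing a :: W, s, t => ∃ s', s = a :: s' ∧ Reduces W s' t

theorem reduces_append {s t : List σ} :
    Reduces (U ++ V) s t ↔ ∃ r, Reduces U s r ∧ Reduces V r t := by
  induction U generalizing s with
  | nil => simp [Reduces]
  | cons p U ih =>
    cases p with
    | opening a => simp only [List.cons_append, Reduces, ih]
    | closing a =>
      simp only [List.cons_append, Reduces, ih]
      constructor
      · rintro ⟨s', h, r, h1, h2⟩
        exact ⟨r, ⟨s', h, h1⟩, h2⟩
      · rintro ⟨r, ⟨s', h, h1⟩, h2⟩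
        exact ⟨s', h, r, h1, h2⟩

theorem Reduces.right_unique {s t t' : List σ} (h : Reduces W s t) (h' : Reduces W s t') :
    t = t' := by
  induction W generalizing s with
  | nil => exact h.symm.trans h'
  | cons p W ih =>
    cases p with
    | opening a => exact ih h h'
    | closing a =>
      obtain ⟨r, rfl, h1⟩ := h
      obtain ⟨r', h2, h3⟩ := h'
      obtain rfl := (List.cons.inj h2).2
      exact ih h1 h3

theorem IsForest.reduces (hF : IsForest F) (s : List σ) : Reduces F s s := by
  induction hF generalizing s with
  | nil => rfl
  | append _ _ h1 h2 => exact reduces_append.mpr ⟨s, h1 s, h2 s⟩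
  | enclose a _ h => exact reduces_append.mpr ⟨a :: s, h _, s, rfl, rfl⟩

/-- Induction on the derivation of `U ++ V`: the insertion point falls into one factor of a
concatenation, or before, after or inside an enclosing pair. -/
theorem IsForest.insert (hP : IsForest P) (h : IsForest (U ++ V)) : IsForest (U ++ P ++ V) := by
  generalize hW : U ++ V = W at h
  induction h generalizing U V with
  | nil =>
    obtain ⟨rfl, rfl⟩ := List.append_eq_nil_iff.mp hW
    simpa using hP
  | @append F G hF hG ihF ihG =>
    rcases List.append_eq_append_iff.mp hW with ⟨A, rfl, rfl⟩ | ⟨A, rfl, rfl⟩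
    · have := (ihF rfl).append hG
      simpa using this
    · have := hF.append (ihG rfl)
      simpa using this
  | @enclose a F hF ih =>
    cases U with
    | nil =>
      obtain rfl : V = _ := hW
      exact hP.append (hF.enclose a)
    | cons p U =>
      obtain ⟨rfl, hW⟩ := List.cons.inj hW
      rcases List.eq_nil_or_concat V with rfl | ⟨V, q, rfl⟩
      · have hU : U = F ++ [Paren.closing a] := by simpa using hW
        subst hU
        have := (hF.enclose a).append hP
        simpa using this
      · rw [List.concat_eq_append] at hW ⊢
        have hW : U ++ V ++ [q] = F ++ [Paren.closing a] := by simpa using hW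
        obtain ⟨h1, h2⟩ := List.append_inj' hW rfl
        obtain rfl := (List.cons.inj h2).1
        have := (ih h1).enclose a
        simpa using this

/-- The stack records the openings not yet closed, so it is put back in front of the unread text. A
closing parenthesis forms an empty pair with the last of them, and such a pair can be inserted into
a forest. -/
theorem isForest_of_reduces {s : List σ} (h : Reduces W s []) :
    IsForest (s.reverse.map Paren.opening ++ W) := by
  induction W generalizing s with
  | nil =>
    obtain rfl : s = [] := h
    exact .nil
  | cons p W ih =>
    cases p with
    | opening a =>
      have := ih (s := a :: s) h
      simpa using this
    | closing a =>
      obtain ⟨r, rfl, h⟩ := h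
      have := (IsForest.nil.enclose a).insert (ih h)
      simpa using this

theorem isForest_iff_reduces : IsForest W ↔ Reduces W [] [] :=
  ⟨fun h => h.reduces [], fun h => by simpa using isForest_of_reduces h⟩

/-- Reading with a stack is deterministic and a forest returns every stack to itself, so skipping
`P` leaves the rest of the reading unchanged. -/
theorem IsForest.remove (hP : IsForest P) (h : IsForest (U ++ P ++ V)) : IsForest (U ++ V) := by
  rw [isForest_iff_reduces] at h ⊢
  obtain ⟨r, h1, h2⟩ := reduces_append.mp h
  obtain ⟨r', h3, h4⟩ := reduces_append.mp h1
  obtain rfl := (hP.reduces r').right_unique h4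
  exact reduces_append.mpr ⟨_, h3, h2⟩

theorem IsForest.replace (hP : IsForest P) (hP' : IsForest P') (h : IsForest (U ++ P ++ V)) :
    IsForest (U ++ P' ++ V) := hP'.insert (hP.remove h)

theorem Reduces.height_eq {s t : List σ} (h : Reduces W s t) :
    height W = t.length - s.length := by
  induction W generalizing s with
  | nil => obtain rfl : s = t := h; simp
  | cons p W ih =>
    cases p with
    | opening a =>
      have := ih (s := a :: s) h
      simp only [height_cons, Paren.sign, this, List.length_cons]
      push_cast
      ring
    | closing a =>
      obtain ⟨r, rfl, h⟩ := h
      simp only [height_cons, Paren.sign, ih h, List.length_cons]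
      push_cast
      ring

/-- As long as the height does not drop below that of `t`, the bottom part `t` of the stack is never
touched. -/
theorem Reduces.of_append {s t u : List σ} (h : Reduces W (s ++ t) u)
    (hW : ∀ i, 0 ≤ (s.length : ℤ) + prefixHeight W i) : ∃ u', u = u' ++ t ∧ Reduces W s u' := by
  induction W generalizing s with
  | nil => exact ⟨s, (show s ++ t = u from h).symm, rfl⟩
  | cons p W ih =>
    have hs : ∀ i, 0 ≤ (s.length : ℤ) + p.sign + prefixHeight W i := by
      intro i
      have := hW (i + 1)
      rwa [prefixHeight, List.take_succ_cons, height_cons, ← add_assoc] at this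
    cases p with
    | opening a =>
      refine ih (s := a :: s) h fun i => ?_
      have := hs i
      simpa [Paren.sign] using this
    | closing a =>
      obtain ⟨r, hr, h⟩ := h
      cases s with
      | nil =>
        have := hs 0
        simp [Paren.sign, prefixHeight] at this
      | cons b s =>
        obtain ⟨rfl, rfl⟩ := List.cons.inj hr
        obtain ⟨u', hu, hu'⟩ := ih (s := s) h fun i => by
          have := hs i
          simpa [Paren.sign] using this
        exact ⟨u', hu, s, rfl, hu'⟩

/-- The prefix up to `i` leaves some stack. The fragment never digs into it and ends at the same
height, so by itself it reads from the empty stack to the empty stack. -/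
theorem isForest_frag (hF : IsForest F) {i j : ℕ} (hij : i ≤ j)
    (h : prefixHeight F j = prefixHeight F i)
    (hm : ∀ m, i ≤ m → m ≤ j → prefixHeight F i ≤ prefixHeight F m) :
    IsForest (frag F i j) := by
  have hred := hF.reduces []
  rw [← List.take_append_drop j F, ← take_append_frag F hij] at hred
  obtain ⟨r, h1, -⟩ := reduces_append.mp hred
  obtain ⟨s, -, h2⟩ := reduces_append.mp h1
  obtain ⟨u, hu, hred'⟩ := Reduces.of_append (s := []) (t := s) h2 (by
    intro m
    have := hm (min (i + m) j) (by omega) (by omega)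
    have h3 : (TreeEdit.frag F i j).take m = TreeEdit.frag F i (min (i + m) j) := by
      rw [← take_frag F (min_le_right (i + m) j)]
      unfold TreeEdit.frag
      rw [List.take_take, List.take_take]
      congr 1
      omega
    rw [prefixHeight, h3, height_frag (by omega)]
    simp only [List.length_nil]
    push_cast
    linarith)
  have h4 := hred'.height_eq
  rw [height_frag hij, h] at h4
  have h5 : u.length = 0 := by
    simp only [List.length_nil] at h4
    push_cast at h4
    omega
  rw [List.length_eq_zero_iff] at h5
  subst h5
  exact isForest_iff_reduces.mpr hred'

/-! Nodes -/

theorem IsNode.lt_length {o c : ℕ} (h : IsNode F o c) : c < F.length := by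
  obtain ⟨-, ⟨a, -, hc⟩, -⟩ := h
  exact (List.getElem?_eq_some_iff.mp hc).1

theorem IsNode.prefixHeight_opening {o c : ℕ} (h : IsNode F o c) :
    prefixHeight F (o + 1) = prefixHeight F o + 1 := by
  obtain ⟨-, ⟨a, ho, -⟩, -⟩ := h
  exact prefixHeight_succ ho

theorem IsNode.prefixHeight_closing {o c : ℕ} (h : IsNode F o c) :
    prefixHeight F (c + 1) = prefixHeight F c - 1 := by
  obtain ⟨-, ⟨a, -, hc⟩, -⟩ := h
  exact prefixHeight_succ hc

theorem IsNode.prefixHeight_eq {o c : ℕ} (h : IsNode F o c) :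
    prefixHeight F c = prefixHeight F o + 1 := by
  have h1 := h.2.2.height_eq_zero
  rw [height_frag (show o + 1 ≤ c from h.1)] at h1
  have := h.prefixHeight_opening
  omega

theorem IsNode.lt_prefixHeight {o c m : ℕ} (h : IsNode F o c) (hm : o < m) (hm' : m ≤ c) :
    prefixHeight F o < prefixHeight F m := by
  have h1 := h.2.2.prefixHeight_nonneg (m - (o + 1))
  rw [prefixHeight, take_frag F hm', height_frag (show o + 1 ≤ m from hm)] at h1
  have := h.prefixHeight_opening
  omega

/-- Just after the closing parenthesis the height is back at its value before the opening one,
whereas it is strictly larger throughout the interior of a node. -/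
theorem IsNode.closing_unique {o c c' : ℕ} (h : IsNode F o c) (h' : IsNode F o c') : c = c' := by
  have key : ∀ {c c'}, IsNode F o c → IsNode F o c' → ¬ c < c' := by
    intro c c' h h' hlt
    have h1 := h'.lt_prefixHeight (m := c + 1) (by have := h.1; omega) hlt
    have h2 := h.prefixHeight_closing
    have h3 := h.prefixHeight_eq
    omega
  have h1 := key h h'
  have h2 := key h' h
  omega

theorem IsNode.opening_unique {o o' c : ℕ} (h : IsNode F o c) (h' : IsNode F o' c) : o = o' := by
  have key : ∀ {o o'}, IsNode F o c → IsNode F o' c → ¬ o < o' := by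
    intro o o' h h' hlt
    have h1 := h.lt_prefixHeight (m := o') hlt h'.1.le
    have h2 := h.prefixHeight_eq
    have h3 := h'.prefixHeight_eq
    omega
  have h1 := key h h'
  have h2 := key h' h
  omega

theorem IsNode.opening_ne_closing {o c o' c' : ℕ} (h : IsNode F o c) (h' : IsNode F o' c') :
    o ≠ c' := by
  rintro rfl
  have h1 := h.prefixHeight_opening
  have h2 := h'.prefixHeight_closing
  omega

theorem frag_append_middle {α : Type*} (X Y Z : List α) {i j : ℕ} (hj : j ≤ Y.length) :
    frag (X ++ Y ++ Z) (X.length + i) (X.length + j) = frag Y i j := by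
  unfold frag
  rw [List.append_assoc, List.drop_append, List.drop_eq_nil_of_le (by omega), List.nil_append,
    show X.length + j - (X.length + i) = j - i by omega, Nat.add_sub_cancel_left, List.drop_append,
    List.take_append]
  have : j - i - (Y.length - i) = 0 := by omega
  simp [this]

theorem getElem?_append_middle {α : Type*} (X Y Z : List α) {i : ℕ} (hi : i < Y.length) :
    (X ++ Y ++ Z)[X.length + i]? = Y[i]? := by
  rw [List.append_assoc, List.getElem?_append_right (by omega), Nat.add_sub_cancel_left,
    List.getElem?_append_left hi]

theorem isNode_append_middle {o c : ℕ} (hc : c < P.length) :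
    IsNode (U ++ P ++ V) (U.length + o) (U.length + c) ↔ IsNode P o c := by
  unfold IsNode
  by_cases hoc : o < c
  · rw [getElem?_append_middle U P V (by omega), getElem?_append_middle U P V hc, add_assoc,
      frag_append_middle U P V hc.le]
    simp
  · simp [hoc]

theorem IsForest.exists_isNode (hF : IsForest F) {i : ℕ} (hi : i < F.length) :
    (∃ c, IsNode F i c) ∨ ∃ o, IsNode F o i := by
  induction hF generalizing i with
  | nil => simp at hi
  | @append F G hF hG ihF ihG =>
    rcases lt_or_ge i F.length with h | h
    · have key : ∀ {o c}, IsNode F o c → IsNode (F ++ G) o c := by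
        intro o c h
        simpa using (isNode_append_middle (U := []) (V := G) h.lt_length).mpr h
      rcases ihF h with ⟨c, h⟩ | ⟨o, h⟩
      · exact Or.inl ⟨c, key h⟩
      · exact Or.inr ⟨o, key h⟩
    · obtain ⟨i, rfl⟩ := Nat.exists_eq_add_of_le h
      have key : ∀ {o c}, IsNode G o c → IsNode (F ++ G) (F.length + o) (F.length + c) := by
        intro o c h
        simpa using (isNode_append_middle (U := F) (V := []) h.lt_length).mpr h
      rcases ihG (i := i) (by simpa using hi) with ⟨c, h⟩ | ⟨o, h⟩
      · exact Or.inl ⟨_, key h⟩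
      · exact Or.inr ⟨_, key h⟩
  | @enclose a F hF ih =>
    have hroot : IsNode (Paren.opening a :: (F ++ [Paren.closing a])) 0 (F.length + 1) := by
      refine ⟨by omega, ⟨a, by simp, by simp⟩, ?_⟩
      have := frag_append_middle [Paren.opening a] F [Paren.closing a] (i := 0) le_rfl
      have h2 : frag (Paren.opening a :: (F ++ [Paren.closing a])) (0 + 1) (F.length + 1) = F := by
        rw [show F.length + 1 = 1 + F.length by omega]
        refine Eq.trans (by simpa using this) ?_
        simp [frag]
      rwa [h2]
    have key : ∀ {o c}, IsNode F o c →
        IsNode (Paren.opening a :: (F ++ [Paren.closing a])) (1 + o) (1 + c) := by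
      intro o c h
      simpa using (isNode_append_middle (U := [Paren.opening a]) (V := [Paren.closing a])
        h.lt_length).mpr h
    rcases Nat.eq_zero_or_pos i with rfl | hi0
    · exact Or.inl ⟨_, hroot⟩
    · rcases Nat.lt_or_ge i (F.length + 1) with h | h
      · obtain ⟨i, rfl⟩ := Nat.exists_eq_add_of_le hi0
        rcases ih (i := i) (by omega) with ⟨c, h⟩ | ⟨o, h⟩
        · exact Or.inl ⟨_, key h⟩
        · exact Or.inr ⟨_, key h⟩
      · simp only [List.length_cons, List.length_append, List.length_nil] at hi
        obtain rfl : i = F.length + 1 := by omega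
        exact Or.inr ⟨_, hroot⟩

theorem IsForest.exists_isNode_of_prefixHeight_lt (hF : IsForest F) {i : ℕ} (hi : i < F.length)
    (h : prefixHeight F i < prefixHeight F (i + 1)) : ∃ c, IsNode F i c := by
  rcases hF.exists_isNode hi with h1 | ⟨o, ho⟩
  · exact h1
  · have := ho.prefixHeight_closing
    omega

theorem IsForest.exists_isNode_of_lt_prefixHeight (hF : IsForest F) {i : ℕ} (hi : i < F.length)
    (h : prefixHeight F (i + 1) < prefixHeight F i) : ∃ o, IsNode F o i := by
  rcases hF.exists_isNode hi with ⟨c, hc⟩ | h1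
  · have := hc.prefixHeight_opening
    omega
  · exact h1

/-- The nodes of a forest respect the boundary of a contiguous subforest. -/
theorem IsNode.mem_middle_iff (hP : IsForest P) {o c : ℕ} (h : IsNode (U ++ P ++ V) o c) :
    (U.length ≤ o ∧ o < U.length + P.length) ↔ (U.length ≤ c ∧ c < U.length + P.length) := by
  constructor
  · rintro ⟨h1, h2⟩
    obtain ⟨i, rfl⟩ := Nat.exists_eq_add_of_le h1
    rcases hP.exists_isNode (i := i) (by omega) with ⟨c', hc⟩ | ⟨o', ho⟩
    · have h3 := (isNode_append_middle (U := U) (V := V) hc.lt_length).mpr hc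
      have := h.closing_unique h3
      have := hc.lt_length
      omega
    · have h3 := (isNode_append_middle (U := U) (V := V) ho.lt_length).mpr ho
      exact absurd rfl (h.opening_ne_closing h3)
  · rintro ⟨h1, h2⟩
    obtain ⟨i, rfl⟩ := Nat.exists_eq_add_of_le h1
    rcases hP.exists_isNode (i := i) (by omega) with ⟨c', hc⟩ | ⟨o', ho⟩
    · have h3 := (isNode_append_middle (U := U) (V := V) hc.lt_length).mpr hc
      exact absurd rfl (h3.opening_ne_closing h)
    · have h3 := (isNode_append_middle (U := U) (V := V) ho.lt_length).mpr ho
      have := h.opening_unique h3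
      have := ho.1
      omega

/-! ### Positions and nodes outside a replaced fragment -/

/-- The position in `U ++ P' ++ V`, where `n' = |P'|`, that corresponds to a position outside of the
fragment `P` of `U ++ P ++ V`, where `u = |U|` and `n = |P|`. -/
def shiftPos (u n n' i : ℕ) : ℕ := if i < u then i else i - n + n'

theorem getElem?_shiftPos {α : Type*} (X Y Y' Z : List α) {i : ℕ}
    (hi : i < X.length ∨ X.length + Y.length ≤ i) :
    (X ++ Y' ++ Z)[shiftPos X.length Y.length Y'.length i]? = (X ++ Y ++ Z)[i]? := by
  unfold shiftPos
  rcases hi with hi | hi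
  · rw [if_pos hi, List.append_assoc, List.append_assoc, List.getElem?_append_left hi,
      List.getElem?_append_left hi]
  · rw [if_neg (by omega), List.getElem?_append_right (by simp; omega),
      List.getElem?_append_right (by simpa using hi)]
    congr 1
    simp only [List.length_append]
    omega

theorem IsNode.shiftPos (hP : IsForest P) (hP' : IsForest P') {o c : ℕ}
    (h : IsNode (U ++ P ++ V) o c) (ho : o < U.length ∨ U.length + P.length ≤ o) :
    IsNode (U ++ P' ++ V) (shiftPos U.length P.length P'.length o)
      (shiftPos U.length P.length P'.length c) := by
  have hmem := h.mem_middle_iff hP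
  have hc : c < U.length ∨ U.length + P.length ≤ c := by omega
  obtain ⟨hoc, ⟨a, h1, h2⟩, hf⟩ := h
  refine ⟨?_, ⟨a, ?_, ?_⟩, ?_⟩
  · unfold TreeEdit.shiftPos
    split_ifs <;> omega
  · rwa [getElem?_shiftPos U P P' V ho]
  · rwa [getElem?_shiftPos U P P' V hc]
  · unfold TreeEdit.shiftPos
    rcases hc with hc | hc
    · rw [if_pos hc, if_pos (by omega)]
      have key : ∀ P : List (Paren σ), TreeEdit.frag (U ++ P ++ V) (o + 1) c =
          TreeEdit.frag U (o + 1) c := by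
        intro P
        have := frag_append_middle [] U (P ++ V) (i := o + 1) hc.le
        simpa using this
      rw [key] at hf ⊢
      exact hf
    · rw [if_neg (show ¬ c < U.length by omega)]
      split_ifs with ho'
      -- The node encloses the whole fragment, so its interior changes too; it stays a forest
      -- because `P` and `P'` are forests.
      · have key : ∀ P : List (Paren σ), ∀ d, TreeEdit.frag (U ++ P ++ V) (o + 1)
            (U.length + P.length + d) = U.drop (o + 1) ++ P ++ V.take d := by
          intro P d
          unfold TreeEdit.frag
          rw [List.append_assoc, List.drop_append_of_le_length ho', List.take_append,
            List.take_append, List.length_drop, List.take_of_length_le (by simp; omega),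
            List.take_of_length_le (by omega), List.append_assoc]
          congr 3
          omega
        obtain ⟨d, rfl⟩ := Nat.exists_eq_add_of_le hc
        rw [key] at hf
        rw [show U.length + P.length + d - P.length + P'.length = U.length + P'.length + d by omega,
          key]
        exact hP.replace hP' hf
      · have key : ∀ P : List (Paren σ), ∀ d e, TreeEdit.frag (U ++ P ++ V)
            (U.length + P.length + d) (U.length + P.length + e) = TreeEdit.frag V d e := by
          intro P d e
          unfold TreeEdit.frag
          rw [← List.length_append, List.drop_append, List.drop_eq_nil_of_le (by omega)]
          simp only [List.nil_append]
          congr 1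
          · omega
          · congr 1
            omega
        obtain ⟨d, rfl⟩ := Nat.exists_eq_add_of_le hc
        obtain ⟨e, rfl⟩ := Nat.exists_eq_add_of_le (show U.length + P.length ≤ o by omega)
        rw [add_assoc, key] at hf
        rw [show U.length + P.length + d - P.length + P'.length = U.length + P'.length + d by omega,
          show U.length + P.length + e - P.length + P'.length + 1 =
            U.length + P'.length + (e + 1) by omega, key]
        exact hf

end Forests

/-! Costs of matchings -/

open Classical in
/-- The cost of the matching that `M` induces between the index sets `I` and `J`, whose elements
carry the labels `f` and `g`: unmatched indices are deleted and inserted. -/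
noncomputable def matchingCost {α ι κ : Type*} (w : Option α → Option α → ℝ≥0∞)
    (f : ι → Option α) (g : κ → Option α) (M : ι → κ → Prop) (I : Finset ι) (J : Finset κ) :
    ℝ≥0∞ :=
  (∑ i ∈ I, if ∃ j ∈ J, M i j then 0 else w (f i) none) +
    (∑ j ∈ J, if ∃ i ∈ I, M i j then 0 else w none (g j)) +
    ∑ i ∈ I, ∑ j ∈ J, if M i j then w (f i) (g j) else 0

section MatchingCost

variable {α ι κ : Type*} {w : Option α → Option α → ℝ≥0∞}
  {f : ι → Option α} {g : κ → Option α} {M : ι → κ → Prop} {I : Finset ι} {J : Finset κ}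

/-- Deletions and insertions play dual roles; this transposes the statements about one side to the
other. -/
theorem matchingCost_swap :
    matchingCost (fun a b => w b a) g f (fun j i => M i j) J I = matchingCost w f g M I J := by
  unfold matchingCost
  rw [Finset.sum_comm (s := J)]
  congr 1
  exact add_comm _ _

theorem matchingCost_map {ι' κ' : Type*} [DecidableEq ι'] [DecidableEq κ'] {f' : ι' → Option α}
    {g' : κ' → Option α} {M' : ι' → κ' → Prop} {φ : ι → ι'} {ψ : κ → κ'}
    (hφ : Set.InjOn φ I) (hψ : Set.InjOn ψ J) (hf : ∀ i ∈ I, f' (φ i) = f i)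
    (hg : ∀ j ∈ J, g' (ψ j) = g j) (hM : ∀ i ∈ I, ∀ j ∈ J, M' (φ i) (ψ j) ↔ M i j) :
    matchingCost w f' g' M' (I.image φ) (J.image ψ) = matchingCost w f g M I J := by
  classical
  unfold matchingCost
  rw [Finset.sum_image hφ, Finset.sum_image hψ, Finset.sum_image hφ]
  congr 1
  · congr 1
    · refine Finset.sum_congr rfl fun i hi => ?_
      rw [hf i hi]
      refine if_congr ?_ rfl rfl
      simp only [Finset.mem_image, exists_exists_and_eq_and]
      exact exists_congr fun j => and_congr_right fun hj => hM i hi j hj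
    · refine Finset.sum_congr rfl fun j hj => ?_
      rw [hg j hj]
      refine if_congr ?_ rfl rfl
      simp only [Finset.mem_image, exists_exists_and_eq_and]
      exact exists_congr fun i => and_congr_right fun hi => hM i hi j hj
  · refine Finset.sum_congr rfl fun i hi => ?_
    rw [Finset.sum_image hψ]
    refine Finset.sum_congr rfl fun j hj => ?_
    rw [hf i hi, hg j hj, if_congr (hM i hi j hj) rfl rfl]

theorem matchingCost_insert_left [DecidableEq ι] {a : ι} (ha : a ∉ I) (h : ∀ j ∈ J, ¬ M a j) :
    matchingCost w f g M (insert a I) J = w (f a) none + matchingCost w f g M I J := by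
  classical
  unfold matchingCost
  rw [Finset.sum_insert ha, Finset.sum_insert ha, if_neg (by simpa using h)]
  have h1 : ∀ j ∈ J, (∃ i ∈ insert a I, M i j) ↔ ∃ i ∈ I, M i j := by
    intro j hj
    simp [h j hj]
  have h2 : (∑ j ∈ J, if M a j then w (f a) (g j) else 0) = 0 :=
    Finset.sum_eq_zero fun j hj => if_neg (h j hj)
  have h3 : (∑ j ∈ J, if ∃ i ∈ insert a I, M i j then 0 else w none (g j)) =
      ∑ j ∈ J, if ∃ i ∈ I, M i j then 0 else w none (g j) :=
    Finset.sum_congr rfl fun j hj => if_congr (h1 j hj) rfl rfl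
  rw [h2, zero_add, h3]
  ring

theorem matchingCost_insert_right [DecidableEq κ] {b : κ} (hb : b ∉ J) (h : ∀ i ∈ I, ¬ M i b) :
    matchingCost w f g M I (insert b J) = w none (g b) + matchingCost w f g M I J := by
  rw [← matchingCost_swap, ← matchingCost_swap (M := M)]
  exact matchingCost_insert_left hb h

variable [DecidableEq ι] [DecidableEq κ]

theorem matchingCost_insert_match {a : ι} {b : κ} (ha : a ∉ I) (hb : b ∉ J) (hab : M a b)
    (hr : ∀ j ∈ J, ¬ M a j) (hl : ∀ i ∈ I, ¬ M i b) :
    matchingCost w f g M (insert a I) (insert b J) =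
      w (f a) (g b) + matchingCost w f g M I J := by
  classical
  unfold matchingCost
  have h1 : ∀ i ∈ I, (∃ j ∈ insert b J, M i j) ↔ ∃ j ∈ J, M i j := by
    intro i hi
    simp [hl i hi]
  have h2 : ∀ j ∈ J, (∃ i ∈ insert a I, M i j) ↔ ∃ i ∈ I, M i j := by
    intro j hj
    simp [hr j hj]
  have h3 : (∑ j ∈ J, if M a j then w (f a) (g j) else 0) = 0 :=
    Finset.sum_eq_zero fun j hj => if_neg (hr j hj)
  have h4 : ∀ i ∈ I, (∑ j ∈ insert b J, if M i j then w (f i) (g j) else 0) =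
      ∑ j ∈ J, if M i j then w (f i) (g j) else 0 := by
    intro i hi
    rw [Finset.sum_insert hb, if_neg (hl i hi), zero_add]
  have h5 : (∑ j ∈ J, if ∃ i ∈ insert a I, M i j then 0 else w none (g j)) =
      ∑ j ∈ J, if ∃ i ∈ I, M i j then 0 else w none (g j) :=
    Finset.sum_congr rfl fun j hj => if_congr (h2 j hj) rfl rfl
  have h6 : (∑ i ∈ I, if ∃ j ∈ insert b J, M i j then 0 else w (f i) none) =
      ∑ i ∈ I, if ∃ j ∈ J, M i j then 0 else w (f i) none :=
    Finset.sum_congr rfl fun i hi => if_congr (h1 i hi) rfl rfl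
  rw [Finset.sum_insert ha, Finset.sum_insert hb, Finset.sum_insert ha, Finset.sum_insert hb,
    if_pos ⟨b, Finset.mem_insert_self _ _, hab⟩, if_pos ⟨a, Finset.mem_insert_self _ _, hab⟩,
    if_pos hab, h3, Finset.sum_congr rfl h4, h5, h6]
  ring

/-- By the triangle inequality, the cost of a matching does not increase when two indices with the
same label are removed, unless both of them are matched to other indices. -/
theorem matchingCost_le_insert (tri : ∀ a b c, w a c ≤ w a b + w b c)
    (hM : ∀ i j j', M i j → M i j' → j = j') (hM' : ∀ i i' j, M i j → M i' j → i = i')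
    {a : ι} {b : κ} (ha : a ∉ I) (hb : b ∉ J) (hab : f a = g b)
    (h : ∀ i ∈ I, ∀ j ∈ J, M i b → M a j → False) :
    matchingCost w f g M I J ≤ matchingCost w f g M (insert a I) (insert b J) := by
  by_cases hm : M a b
  · rw [matchingCost_insert_match ha hb hm
      (fun j hj h => hb (hM _ _ _ hm h ▸ hj)) (fun i hi h => ha (hM' _ _ _ hm h ▸ hi))]
    exact le_add_self
  by_cases hl : ∃ i ∈ I, M i b
  · obtain ⟨x, hx, hxb⟩ := hl
    have hr : ∀ j ∈ J, ¬ M a j := fun j hj h' => h x hx j hj hxb h'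
    rw [matchingCost_insert_left (J := insert b J) ha (by
      intro j hj
      rcases Finset.mem_insert.mp hj with rfl | hj
      · exact hm
      · exact hr j hj)]
    obtain ⟨I, hxI, rfl⟩ : ∃ I', x ∉ I' ∧ insert x I' = I :=
      ⟨I.erase x, Finset.notMem_erase _ _, Finset.insert_erase hx⟩
    have hxJ : ∀ j ∈ J, ¬ M x j := fun j hj h' => hb (hM _ _ _ hxb h' ▸ hj)
    rw [matchingCost_insert_match hxI hb hxb hxJ
      (fun i hi h' => hxI (hM' _ _ _ hxb h' ▸ hi)), matchingCost_insert_left hxI hxJ, ← add_assoc]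
    gcongr
    rw [add_comm, hab]
    exact tri _ _ _
  push Not at hl
  rw [matchingCost_insert_right (I := insert a I) hb (by
    intro i hi
    rcases Finset.mem_insert.mp hi with rfl | hi
    · exact hm
    · exact hl i hi)]
  by_cases hr : ∃ j ∈ J, M a j
  · obtain ⟨y, hy, hay⟩ := hr
    obtain ⟨J, hyJ, rfl⟩ : ∃ J', y ∉ J' ∧ insert y J' = J :=
      ⟨J.erase y, Finset.notMem_erase _ _, Finset.insert_erase hy⟩
    have hyI : ∀ i ∈ I, ¬ M i y := fun i hi h' => ha (hM' _ _ _ hay h' ▸ hi)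
    rw [matchingCost_insert_match ha hyJ hay (fun j hj h' => hyJ (hM _ _ _ hay h' ▸ hj)) hyI,
      matchingCost_insert_right hyJ hyI, ← add_assoc]
    gcongr
    rw [← hab]
    exact tri _ _ _
  · push Not at hr
    rw [matchingCost_insert_left ha hr]
    exact le_add_self.trans le_add_self

end MatchingCost

/-! Alignments as matchings -/

namespace Alignment

variable {α : Type*} {X Y : List α} (A : Alignment X Y)

theorem mono {t t' : ℕ} (h : t ≤ t') (ht : t' ≤ A.m) : A.x t ≤ A.x t' ∧ A.y t ≤ A.y t' := by
  induction t', h using Nat.le_induction with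
  | base => exact ⟨le_rfl, le_rfl⟩
  | succ s _ ih =>
    have h1 := ih (by omega)
    have h2 := A.step s (by omega)
    omega

variable {A}

theorem Aligns.lt_iff_lt {i j i' j' : ℕ} (h : A.Aligns i j) (h' : A.Aligns i' j') :
    i < i' ↔ j < j' := by
  obtain ⟨t, ht, h1, h2, h3, h4⟩ := h
  obtain ⟨t', ht', h1', h2', h3', h4'⟩ := h'
  rcases lt_trichotomy t t' with hlt | rfl | hlt
  · have := A.mono (t := t + 1) hlt ht'.le
    omega
  · omega
  · have := A.mono (t := t' + 1) hlt ht.le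
    omega

theorem Aligns.right_unique {i j j' : ℕ} (h : A.Aligns i j) (h' : A.Aligns i j') : j = j' := by
  have h1 := h.lt_iff_lt h'
  have h2 := h'.lt_iff_lt h
  omega

theorem Aligns.left_unique {i i' j : ℕ} (h : A.Aligns i j) (h' : A.Aligns i' j) : i = i' := by
  have h1 := h.lt_iff_lt h'
  have h2 := h'.lt_iff_lt h
  omega

theorem Aligns.lt_length {i j : ℕ} (h : A.Aligns i j) : i < X.length ∧ j < Y.length := by
  obtain ⟨t, ht, h1, h2, h3, h4⟩ := h
  have := A.bounds.2 (t + 1) ht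
  omega

/-- Both coordinates are monotone along the path, so each of its points cuts the matching in two. In
this form a diagonal point enters `exists_replace`. -/
theorem Aligns.lt_iff {i j t : ℕ} (h : A.Aligns i j) (ht : t ≤ A.m) : i < A.x t ↔ j < A.y t := by
  obtain ⟨t', ht', h1, h2, h3, h4⟩ := h
  rcases le_or_gt t t' with hlt | hlt
  · have := A.mono hlt ht'.le
    omega
  · have := A.mono (t := t' + 1) hlt ht
    omega

theorem not_aligns_of_deletes {i j : ℕ} (h : A.Deletes i) : ¬ A.Aligns i j := by
  rintro h'
  obtain ⟨t, ht, h1, h2, h3⟩ := h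
  have h4 := h'.lt_iff (t := t) ht.le
  have h5 := h'.lt_iff (t := t + 1) ht
  omega

variable (A)

theorem exists_x_eq {i : ℕ} (hi : i ≤ X.length) : ∃ t ≤ A.m, A.x t = i := by
  by_contra! hne
  have : ∀ t ≤ A.m, A.x t < i := by
    intro t
    induction t with
    | zero =>
      intro h
      have := hne 0 h
      have := A.x_zero
      omega
    | succ t ih =>
      intro h
      have h1 := ih (by omega)
      have h2 := hne (t + 1) h
      have h3 := A.step t (by omega)
      omega
  have h1 := this A.m le_rfl
  have h2 := A.x_last
  omega

theorem deletes_or_aligns {i : ℕ} (hi : i < X.length) : A.Deletes i ∨ ∃ j, A.Aligns i j := by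
  classical
  have hex := A.exists_x_eq (i := i + 1) hi
  have h1 := Nat.find_spec hex
  have h2 := fun {t} => Nat.find_min hex (m := t)
  set t := Nat.find hex
  have ht : t ≠ 0 := by
    intro h
    have := A.x_zero
    rw [h] at h1
    omega
  obtain ⟨s, hs⟩ := Nat.exists_eq_succ_of_ne_zero ht
  have h3 := h2 (t := s) (by omega)
  have h4 := A.step s (by omega)
  rw [hs] at h1
  rw [Nat.succ_eq_add_one] at h1
  have h5 : A.x s ≠ i + 1 := fun h => h3 ⟨by omega, h⟩
  rcases h4 with h4 | h4 | h4
  · exact Or.inr ⟨A.y s, s, by omega, by omega, rfl, by omega, by omega⟩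
  · exact Or.inl ⟨s, by omega, by omega, by omega, by omega⟩
  · omega

theorem deletes_iff {i : ℕ} (hi : i < X.length) : A.Deletes i ↔ ∀ j, ¬ A.Aligns i j := by
  refine ⟨fun h j => not_aligns_of_deletes h, fun h => ?_⟩
  rcases A.deletes_or_aligns hi with h' | ⟨j, h'⟩
  · exact h'
  · exact absurd h' (h j)

/-- Along the path, each step adds one index, or one matched pair, to the two prefixes already
covered. The gain is that a matching, unlike a path, can be restricted to arbitrary index sets. -/
theorem cost_eq_matchingCost (w : Option α → Option α → ℝ≥0∞) :
    A.cost w = matchingCost w (fun i => X[i]?) (fun j => Y[j]?) A.Aligns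
      (Finset.range X.length) (Finset.range Y.length) := by
  have key : ∀ t ≤ A.m, ∑ s ∈ Finset.range t, A.stepCost w s =
      matchingCost w (fun i => X[i]?) (fun j => Y[j]?) A.Aligns
        (Finset.range (A.x t)) (Finset.range (A.y t)) := by
    intro t
    induction t with
    | zero =>
      intro _
      simp [A.x_zero, A.y_zero, matchingCost]
    | succ t ih =>
      intro ht
      rw [Finset.sum_range_succ, ih (by omega), add_comm]
      rcases A.step t ht with h | h | h
      · have hal : A.Aligns (A.x t) (A.y t) := ⟨t, ht, rfl, rfl, h.1, h.2⟩
        rw [h.1, h.2, Finset.range_add_one, Finset.range_add_one,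
          matchingCost_insert_match (by simp) (by simp) hal, stepCost, if_neg (by omega),
          if_neg (by omega)]
        · intro j hj h'
          have := hal.right_unique h'
          simp at hj
          omega
        · intro i hi h'
          have := hal.left_unique h'
          simp at hi
          omega
      · rw [h.1, h.2, Finset.range_add_one, matchingCost_insert_left (by simp), stepCost,
          if_pos h.2]
        exact fun j _ => not_aligns_of_deletes ⟨t, ht, rfl, h.1, h.2⟩
      · rw [h.1, h.2, Finset.range_add_one, matchingCost_insert_right (by simp), stepCost,
          if_neg (by omega), if_pos h.1]
        intro i hi h'
        have h1 := h'.lt_iff (t := t) (by omega)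
        have h2 := h'.lt_iff (t := t + 1) ht
        omega
  have := key A.m le_rfl
  rwa [A.x_last, A.y_last] at this

variable {A}

/-- A noncrossing matching is the set of aligned pairs of an alignment. -/
theorem exists_aligns_iff {M : ℕ → ℕ → Prop}
    (hb : ∀ i j, M i j → i < X.length ∧ j < Y.length)
    (hM : ∀ i j i' j', M i j → M i' j' → (i < i' ↔ j < j')) :
    ∃ A : Alignment X Y, ∀ i j, A.Aligns i j ↔ M i j := by
  -- A path to any point `(a, b)` that cuts the matching, built from its last step backwards.
  -- Requiring deleted positions to be unmatched ensures that every pair of `M` gets aligned.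
  have key : ∀ n a b, a + b = n → (∀ i j, M i j → (i < a ↔ j < b)) →
      ∃ (m : ℕ) (x y : ℕ → ℕ), x 0 = 0 ∧ y 0 = 0 ∧ x m = a ∧ y m = b ∧
        ∀ t < m, (x (t + 1) = x t + 1 ∧ y (t + 1) = y t + 1 ∧ M (x t) (y t)) ∨
          (x (t + 1) = x t + 1 ∧ y (t + 1) = y t ∧ ∀ j, ¬ M (x t) j) ∨
          (x (t + 1) = x t ∧ y (t + 1) = y t + 1) := by
    intro n
    induction n using Nat.strong_induction_on with
    | _ n ih =>
    intro a b hab hcut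
    -- extension of a path by a last step
    have ext : ∀ a' b', a' + b' < n → (∀ i j, M i j → (i < a' ↔ j < b')) →
        ((a = a' + 1 ∧ b = b' + 1 ∧ M a' b') ∨ (a = a' + 1 ∧ b = b' ∧ ∀ j, ¬ M a' j) ∨
          (a = a' ∧ b = b' + 1)) →
        ∃ (m : ℕ) (x y : ℕ → ℕ), x 0 = 0 ∧ y 0 = 0 ∧ x m = a ∧ y m = b ∧
        ∀ t < m, (x (t + 1) = x t + 1 ∧ y (t + 1) = y t + 1 ∧ M (x t) (y t)) ∨
          (x (t + 1) = x t + 1 ∧ y (t + 1) = y t ∧ ∀ j, ¬ M (x t) j) ∨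
          (x (t + 1) = x t ∧ y (t + 1) = y t + 1) := by
      intro a' b' hlt hcut' hlast
      obtain ⟨m, x, y, hx0, hy0, hxm, hym, hstep⟩ := ih _ hlt a' b' rfl hcut'
      refine ⟨m + 1, fun t => if t ≤ m then x t else a, fun t => if t ≤ m then y t else b,
        by simpa, by simpa, by simp, by simp, ?_⟩
      intro t ht
      rcases Nat.lt_succ_iff_lt_or_eq.mp ht with ht | rfl
      · have h1 : t ≤ m := ht.le
        have h2 : t + 1 ≤ m := ht
        simp only [h1, h2, if_true]
        exact hstep t ht
      · simp only [le_refl, if_true, show ¬ t + 1 ≤ t by omega, if_false, hxm, hym]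
        exact hlast
    by_cases ha : a ≠ 0 ∧ ∀ j, ¬ M (a - 1) j
    · refine ext (a - 1) b (by omega) ?_ (Or.inr (Or.inl ⟨by omega, rfl, ha.2⟩))
      intro i j h
      rw [← hcut i j h]
      have : i ≠ a - 1 := by
        rintro rfl
        exact ha.2 j h
      omega
    by_cases hb' : b ≠ 0 ∧ ∀ i, ¬ M i (b - 1)
    · refine ext a (b - 1) (by omega) ?_ (Or.inr (Or.inr ⟨rfl, by omega⟩))
      intro i j h
      rw [hcut i j h]
      have : j ≠ b - 1 := by
        rintro rfl
        exact hb'.2 i h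
      omega
    have ha1 : a ≠ 0 → ∃ j, M (a - 1) j := by
      intro h
      by_contra! h'
      exact ha ⟨h, h'⟩
    have hb1 : b ≠ 0 → ∃ i, M i (b - 1) := by
      intro h
      by_contra! h'
      exact hb' ⟨h, h'⟩
    by_cases ha0 : a = 0
    · by_cases hb0 : b = 0
      · exact ⟨0, fun _ => 0, fun _ => 0, rfl, rfl, ha0.symm, hb0.symm, fun t ht => by omega⟩
      · obtain ⟨i, hi⟩ := hb1 hb0
        have := hcut _ _ hi
        omega
    · obtain ⟨j, hj⟩ := ha1 ha0
      have h1 := hcut _ _ hj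
      obtain ⟨i, hi⟩ := hb1 (by omega)
      have h2 := hcut _ _ hi
      -- Both last positions are matched before the cut, so noncrossing forces them to be matched to
      -- each other.
      have h3 := hM _ _ _ _ hi hj
      have h4 := hM _ _ _ _ hj hi
      obtain rfl : j = b - 1 := by omega
      refine ext (a - 1) (b - 1) (by omega) ?_ (Or.inl ⟨by omega, by omega, hj⟩)
      intro i' j' h
      exact hM _ _ _ _ h hj
  obtain ⟨m, x, y, hx0, hy0, hxm, hym, hstep⟩ := key _ X.length Y.length rfl
    (fun i j h => by have := hb i j h; omega)
  let A : Alignment X Y :=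
    { m := m, x := x, y := y, x_zero := hx0, y_zero := hy0, x_last := hxm, y_last := hym
      step := fun t ht => by
        rcases hstep t ht with h | h | h
        · exact Or.inl ⟨h.1, h.2.1⟩
        · exact Or.inr (Or.inl ⟨h.1, h.2.1⟩)
        · exact Or.inr (Or.inr h) }
  have hsub : ∀ i j, A.Aligns i j → M i j := by
    rintro i j ⟨t, ht, rfl, rfl, h1, h2⟩
    change x (t + 1) = x t + 1 at h1
    change y (t + 1) = y t + 1 at h2
    rcases hstep t ht with h | h | h
    · exact h.2.2
    · omega
    · omega
  refine ⟨A, fun i j => ⟨hsub i j, fun h => ?_⟩⟩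
  rcases A.deletes_or_aligns (hb i j h).1 with ⟨t, ht, hi, h1, h2⟩ | ⟨j', h'⟩
  · subst hi
    change x (t + 1) = x t + 1 at h1
    change y (t + 1) = y t at h2
    rcases hstep t ht with h3 | h3 | h3
    · omega
    · exact absurd h (h3.2.2 j)
    · omega
  · have h1 := hM _ _ _ _ (hsub _ _ h') h
    have h2 := hM _ _ _ _ h (hsub _ _ h')
    obtain rfl : j = j' := by omega
    exact h'

end Alignment

/-! Integer sequences -/

theorem exists_last_min (f : ℕ → ℤ) {a b : ℕ} (hab : a ≤ b) :
    ∃ m, a ≤ m ∧ m ≤ b ∧ (∀ i, a ≤ i → i ≤ b → f m ≤ f i) ∧ ∀ i, m < i → i ≤ b → f m < f i := by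
  induction b, hab using Nat.le_induction with
  | base =>
    exact ⟨a, le_rfl, le_rfl, fun i h1 h2 => by rw [le_antisymm h1 h2], fun i _ _ => by omega⟩
  | succ b hab ih =>
    obtain ⟨m, h1, h2, h3, h4⟩ := ih
    rcases le_or_gt (f (b + 1)) (f m) with h | h
    · refine ⟨b + 1, by omega, le_rfl, fun i hi hi' => ?_, fun i _ _ => by omega⟩
      rcases Nat.lt_or_ge b i with hb | hb
      · rw [show i = b + 1 by omega]
      · exact h.trans (h3 i hi hb)
    · refine ⟨m, h1, by omega, fun i hi hi' => ?_, fun i hi hi' => ?_⟩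
      · rcases Nat.lt_or_ge b i with hb | hb
        · rw [show i = b + 1 by omega]
          exact h.le
        · exact h3 i hi hb
      · rcases Nat.lt_or_ge b i with hb | hb
        · rwa [show i = b + 1 by omega]
        · exact h4 i hi hb

theorem exists_first_min (f : ℕ → ℤ) {a b : ℕ} (hab : a ≤ b) :
    ∃ m, a ≤ m ∧ m ≤ b ∧ (∀ i, a ≤ i → i ≤ b → f m ≤ f i) ∧ ∀ i, a ≤ i → i < m → f m < f i := by
  induction b, hab using Nat.le_induction with
  | base =>
    exact ⟨a, le_rfl, le_rfl, fun i h1 h2 => by rw [le_antisymm h1 h2], fun i _ _ => by omega⟩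
  | succ b hab ih =>
    obtain ⟨m, h1, h2, h3, h4⟩ := ih
    rcases lt_or_ge (f (b + 1)) (f m) with h | h
    · refine ⟨b + 1, by omega, le_rfl, fun i hi hi' => ?_, fun i hi hi' => ?_⟩
      · rcases Nat.lt_or_ge b i with hb | hb
        · rw [show i = b + 1 by omega]
        · exact h.le.trans (h3 i hi hb)
      · exact h.trans_le (h3 i hi (by omega))
    · refine ⟨m, h1, by omega, fun i hi hi' => ?_, h4⟩
      rcases Nat.lt_or_ge b i with hb | hb
      · rwa [show i = b + 1 by omega]
      · exact h3 i hi hb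

theorem exists_eq_zero_of_unit_steps {e : ℕ → ℤ} {a b : ℕ} (hab : a ≤ b)
    (hstep : ∀ t, a ≤ t → t < b → |e (t + 1) - e t| ≤ 1) (ha : e a ≤ 0) (hb : 0 ≤ e b) :
    ∃ t, a ≤ t ∧ t ≤ b ∧ e t = 0 := by
  induction b, hab using Nat.le_induction with
  | base => exact ⟨a, le_rfl, le_rfl, by omega⟩
  | succ b hab ih =>
    by_cases h : 0 ≤ e b
    · obtain ⟨t, h1, h2, h3⟩ := ih (fun t h1 h2 => hstep t h1 (by omega)) h
      exact ⟨t, h1, by omega, h3⟩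
    · have := abs_le.mp (hstep b hab (by omega))
      exact ⟨b + 1, by omega, le_rfl, by omega⟩

/-- Pigeonhole: among `n + 1` disjoint blocks of length `L`, one contains none of the at most `n`
marked steps. -/
theorem exists_run {p : ℕ → Prop} [DecidablePred p] {m n L a b : ℕ}
    (hp : ((Finset.range m).filter p).card ≤ n) (hab : a + (n + 1) * L ≤ b) (hb : b ≤ m) :
    ∃ t, a ≤ t ∧ t + L ≤ b ∧ ∀ r < L, ¬ p (t + r) := by
  by_contra! hno
  have hblock : ∀ j : ℕ, ∃ r, j < n + 1 → r < L ∧ p (a + j * L + r) := by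
    intro j
    by_cases hj : j < n + 1
    · have h1 : (j + 1) * L ≤ (n + 1) * L := Nat.mul_le_mul_right _ hj
      obtain ⟨r, hr, hr'⟩ := hno (a + j * L) (by omega) (by rw [add_mul] at h1; omega)
      exact ⟨r, fun _ => ⟨hr, hr'⟩⟩
    · exact ⟨0, fun h => absurd h hj⟩
  choose r hr using hblock
  have h1 : (Finset.range (n + 1)).card ≤ ((Finset.range m).filter p).card := by
    refine Finset.card_le_card_of_injOn (fun j => a + j * L + r j) ?_ ?_
    · intro j hj
      have hj : j < n + 1 := by simpa using hj
      have h2 := hr j hj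
      have h3 : (j + 1) * L ≤ (n + 1) * L := Nat.mul_le_mul_right _ hj
      rw [add_mul] at h3
      simp only [Finset.coe_filter, Finset.mem_range, Set.mem_ofPred_eq]
      exact ⟨by omega, h2.2⟩
    · have key : ∀ i j, i < n + 1 → i < j → a + i * L + r i < a + j * L + r j := by
        intro i j hi hij
        have h2 := (hr i hi).1
        have h3 : (i + 1) * L ≤ j * L := Nat.mul_le_mul_right _ hij
        rw [add_mul] at h3
        omega
      intro i hi j hj hij
      have hi : i < n + 1 := by simpa using hi
      have hj : j < n + 1 := by simpa using hj
      rcases lt_trichotomy i j with h | h | h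
      · exact absurd hij (key i j hi h).ne
      · exact h
      · exact absurd hij (key j i hj h).ne'
  rw [Finset.card_range] at h1
  omega

/-! Periodic fragments -/

section Periodicity

variable {σ : Type*} {P : List (Paren σ)}

theorem frag_eq_frag {α : Type*} {X : List α} {i j n : ℕ}
    (h : ∀ r < n, X[i + r]? = X[j + r]?) : frag X i (i + n) = frag X j (j + n) := by
  unfold frag
  refine List.ext_getElem? fun r => ?_
  rw [List.getElem?_take, List.getElem?_take, List.getElem?_drop, List.getElem?_drop]
  split_ifs with h1 h2 h2
  · exact h r (by omega)
  · omega
  · omega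
  · rfl

theorem frag_append_frag {α : Type*} (X : List α) {i j l : ℕ} (hij : i ≤ j) (hjl : j ≤ l) :
    frag X i j ++ frag X j l = frag X i l := by
  unfold frag
  rw [show l - i = (j - i) + (l - j) by omega, List.take_add, List.drop_drop,
    show i + (j - i) = j by omega]

theorem frag_eq_pow {α : Type*} {X : List α} {m s n : ℕ}
    (h : ∀ j < n, frag X (m + j * s) (m + j * s + s) = frag X m (m + s)) :
    frag X m (m + n * s) = pow (frag X m (m + s)) n := by
  induction n with
  | zero => simp [frag, pow]
  | succ n ih =>
    rw [pow, List.replicate_succ', List.flatten_append, ← pow,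
      ← ih fun j hj => h j (by omega), ← frag_append_frag X (j := m + n * s) (by omega)
      (by rw [add_mul]; omega), add_mul, one_mul, ← add_assoc, h n (by omega)]
    simp

/-- If a forest without horizontal periodicity has a long fragment with a short period `s`, then
there are two nodes, one of them nested in the other, whose opening or closing parentheses are `s`
positions apart within this fragment. -/
theorem exists_nested_nodes_of_periodic (hP : IsForest P) {k : ℕ}
    (havoid : AvoidsHorizontalPeriodicity k P) {b s L : ℕ} (hs : 0 < s) (hsk : s ≤ 4 * k)
    (hL : (4 * k + 1) * s ≤ L) (hlen : b + s + L ≤ P.length)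
    (hper : ∀ r < L, P[b + s + r]? = P[b + r]?) :
    ∃ r < L, ∃ i j, i < j ∧ ((IsNode P (b + s + r) i ∧ IsNode P (b + r) j) ∨
      (IsNode P i (b + s + r) ∧ IsNode P j (b + r))) := by
  have hsL : s ≤ L := le_trans (by nlinarith) hL
  set f := prefixHeight P with hf
  -- The gain of height over one period; by periodicity it is the same everywhere in the fragment.
  obtain ⟨h, hh⟩ : ∃ h, h = f (b + s) - f b := ⟨_, rfl⟩
  have hshift : ∀ r ≤ L, f (b + s + r) = f (b + r) + h := by
    intro r
    induction r with
    | zero => intro _; simp only [add_zero]; omega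
    | succ r ih =>
      intro hr
      have h1 := ih (by omega)
      have h2 : P[b + r]? = some P[b + r] := List.getElem?_eq_getElem (by omega)
      have h3 := prefixHeight_succ h2
      have h4 := prefixHeight_succ ((hper r hr).trans h2)
      rw [← hf] at h3 h4
      rw [← add_assoc, ← add_assoc]
      omega
  have hshift' : ∀ m, b ≤ m → m ≤ b + L → f (m + s) = f m + h := by
    intro m h1 h2
    have := hshift (m - b) (by omega)
    rwa [show b + s + (m - b) = m + s by omega, show b + (m - b) = m by omega] at this
  rcases lt_trichotomy h 0 with hneg | hzero | hpos
  -- The heights descend. The first minimum of the second period is strictly below the `s` heights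
  -- before it, so the node closing at `m - 1` opens before `m - 1 - s` and encloses the node that
  -- closes there.
  · obtain ⟨m, hm1, hm2, hm3, hm4⟩ := exists_first_min f (show b + s ≤ b + s + s by omega)
    have h1 := hm3 (b + s + s) (by omega) le_rfl
    have h2 := hshift' (b + s) (by omega) (by omega)
    have hne : m ≠ b + s := by rintro rfl; omega
    have hlow : ∀ i, m - s ≤ i → i < m → f m < f i := by
      intro i hi hi'
      rcases Nat.lt_or_ge i (b + s) with hb | hb
      · have h3 := hshift' i (by omega) (by omega)
        have h4 := hm3 (i + s) (by omega) (by omega)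
        omega
      · exact hm4 i hb hi'
    have hc : f (m - 1 + 1) < f (m - 1) := by
      rw [Nat.sub_add_cancel (by omega)]
      exact hlow _ (by omega) (by omega)
    have hc' : f (m - 1 - s + 1) < f (m - 1 - s) := by
      have h3 := hshift' (m - 1 - s) (by omega) (by omega)
      have h4 := hshift' (m - 1 - s + 1) (by omega) (by omega)
      rw [show m - 1 - s + s = m - 1 by omega] at h3
      rw [show m - 1 - s + 1 + s = m - 1 + 1 by omega] at h4
      omega
    obtain ⟨i, hi⟩ := hP.exists_isNode_of_lt_prefixHeight (by omega) hc
    obtain ⟨j, hj⟩ := hP.exists_isNode_of_lt_prefixHeight (by omega) hc'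
    refine ⟨m - 1 - s - b, by omega, i, j, ?_, Or.inr ⟨?_, ?_⟩⟩
    · have h5 := hi.prefixHeight_eq
      have h6 := hi.prefixHeight_closing
      have h7 := hj.prefixHeight_eq
      have h8 := hj.prefixHeight_closing
      rw [← hf] at h5 h6 h7 h8
      have h9 := hlow (m - 1 - s + 1) (by omega) (by omega)
      rw [Nat.sub_add_cancel (show 1 ≤ m by omega)] at h6
      by_contra hij
      have hji := hj.1
      rcases Nat.lt_or_ge i (m - 1 - s) with h10 | h10
      · rcases Nat.eq_or_lt_of_le (Nat.le_of_not_lt hij) with h11 | h11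
        · subst h11
          omega
        · have := hj.lt_prefixHeight h11 h10.le
          rw [← hf] at this
          omega
      · have := hlow i
        have h11 := hi.1
        have h12 : m - s ≤ i := by
          have : i ≠ m - 1 - s := by
            rintro rfl
            exact absurd rfl (hi.opening_ne_closing hj)
          omega
        have := hlow i h12 (by omega)
        omega
    · rwa [show b + s + (m - 1 - s - b) = m - 1 by omega]
    · rwa [show b + (m - 1 - s - b) = m - 1 - s by omega]
  -- A minimum over one period is a minimum over the whole fragment, so the period starting there is
  -- a forest, and it repeats `4k + 1` times.
  · obtain ⟨m, hm1, hm2, hm3, -⟩ := exists_last_min f (show b ≤ b + s by omega)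
    subst hzero
    have hmin : ∀ i, b ≤ i → i ≤ b + s + L → f m ≤ f i := by
      intro i
      induction i using Nat.strong_induction_on with
      | _ i ih =>
        intro h1 h2
        rcases Nat.lt_or_ge (b + s) i with h3 | h3
        · have h4 := ih (i - s) (by omega) (by omega) (by omega)
          have h5 := hshift' (i - s) (by omega) (by omega)
          rw [Nat.sub_add_cancel (by omega)] at h5
          omega
        · exact hm3 i h1 h3
    have hlen' : m + (4 * k + 1) * s ≤ P.length := by omega
    have hsn : s ≤ (4 * k + 1) * s := by nlinarith
    have hQlen : (frag P m (m + s)).length = s := by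
      unfold frag
      rw [List.length_take, List.length_drop]
      omega
    have hfrag : frag P m (m + (4 * k + 1) * s) = pow (frag P m (m + s)) (4 * k + 1) := by
      refine frag_eq_pow fun j hj => ?_
      induction j with
      | zero => simp
      | succ j ih =>
        rw [← ih (by omega)]
        refine frag_eq_frag fun r hr => ?_
        have h1 : (j + 2) * s ≤ (4 * k + 1) * s := Nat.mul_le_mul_right _ (by omega)
        rw [show (j + 2) * s = j * s + s + s by ring] at h1
        have := hper (m - b + j * s + r) (by omega)
        rw [show b + s + (m - b + j * s + r) = m + (j + 1) * s + r by rw [add_mul]; omega,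
          show b + (m - b + j * s + r) = m + j * s + r by omega] at this
        exact this
    have hpow : (pow (frag P m (m + s)) (4 * k + 1)).length = (4 * k + 1) * s := by
      simp [pow, hQlen]
    refine absurd ⟨frag P m (m + s), ?_, ?_, ?_, m, ?_, ?_⟩ havoid
    · refine isForest_frag hP (by omega) ?_ fun i h1 h2 => hmin i (by omega) (by omega)
      have := hshift' m (by omega) (by omega)
      simpa using this
    · omega
    · omega
    · omega
    · rw [hpow, hfrag]
  -- The heights ascend. The last minimum of the first period is strictly below the next `s`
  -- heights, so the node opening at `m` is still open at `m + s` and encloses the node that opens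
  -- there.
  · obtain ⟨m, hm1, hm2, hm3, hm4⟩ := exists_last_min f (show b ≤ b + s by omega)
    have h1 := hm3 b le_rfl (by omega)
    have hne : m ≠ b + s := by rintro rfl; omega
    have hlow : ∀ i, m < i → i ≤ m + s → f m < f i := by
      intro i hi hi'
      rcases Nat.lt_or_ge (b + s) i with hb | hb
      · have h3 := hshift' (i - s) (by omega) (by omega)
        rw [Nat.sub_add_cancel (by omega)] at h3
        have h4 := hm3 (i - s) (by omega) (by omega)
        omega
      · exact hm4 i hi hb
    have ho' : f m < f (m + 1) := hlow _ (by omega) (by omega)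
    have ho : f (m + s) < f (m + s + 1) := by
      have h3 := hshift' m (by omega) (by omega)
      have h4 := hshift' (m + 1) (by omega) (by omega)
      rw [show m + 1 + s = m + s + 1 by omega] at h4
      omega
    obtain ⟨j, hj⟩ := hP.exists_isNode_of_prefixHeight_lt (by omega) ho'
    obtain ⟨i, hi⟩ := hP.exists_isNode_of_prefixHeight_lt (by omega) ho
    refine ⟨m - b, by omega, i, j, ?_, Or.inl ⟨?_, ?_⟩⟩
    · have h5 := hi.prefixHeight_eq
      have h6 := hi.prefixHeight_closing
      have h7 := hj.prefixHeight_eq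
      have h8 := hj.prefixHeight_closing
      rw [← hf] at h5 h6 h7 h8
      have h9 := hlow (m + s) (by omega) le_rfl
      have hji := hj.1
      by_contra hij
      rcases Nat.lt_or_ge (m + s) j with h10 | h10
      · rcases Nat.eq_or_lt_of_le (Nat.le_of_not_lt hij) with h11 | h11
        · subst h11
          omega
        · have := hi.lt_prefixHeight (m := j + 1) (by omega) h11
          rw [← hf] at this
          omega
      · have h12 : j ≠ m + s := by
          rintro rfl
          exact absurd rfl (hi.opening_ne_closing hj)
        have := hlow (j + 1) (by omega) (by omega)
        omega
    · rwa [show b + s + (m - b) = m + s by omega]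
    · rwa [show b + (m - b) = m by omega]

end Periodicity

/-! Alignments of small cost -/

namespace Alignment

section

variable {α : Type*} {X Y : List α} (A : Alignment X Y)

/-- Step `t` of `A` is an edit, that is, it does not align two equal characters. -/
def IsEdit (t : ℕ) : Prop :=
  ¬ (A.x (t + 1) = A.x t + 1 ∧ A.y (t + 1) = A.y t + 1 ∧ X[A.x t]? = Y[A.y t]?)

-- An edit changes `x - y` by at most one, and all other steps leave it unchanged.
open Classical in
theorem abs_x_sub_y_le {n : ℕ} (h : ((Finset.range A.m).filter A.IsEdit).card ≤ n) {t : ℕ}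
    (ht : t ≤ A.m) : |(A.x t : ℤ) - A.y t| ≤ n := by
  have key : ∀ t ≤ A.m,
      |(A.x t : ℤ) - A.y t| ≤ ((Finset.range t).filter A.IsEdit).card := by
    intro t
    induction t with
    | zero => intro _; simp [A.x_zero, A.y_zero]
    | succ t ih =>
      intro ht
      have h1 := ih (by omega)
      have h2 := A.step t ht
      rw [Finset.range_add_one, Finset.filter_insert]
      rw [abs_le] at h1 ⊢
      split_ifs with h3
      · rw [Finset.card_insert_of_notMem (by simp)]
        push_cast
        omega
      · rw [IsEdit, not_not] at h3
        omega
  refine (key t ht).trans ?_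
  have : ((Finset.range t).filter A.IsEdit).card ≤ ((Finset.range A.m).filter A.IsEdit).card :=
    Finset.card_le_card (Finset.filter_subset_filter _ (Finset.range_subset_range.mpr ht))
  exact_mod_cast this.trans h

end

section

variable {σ : Type*} {F G : List (Paren σ)} {A : Alignment F G}
  {w : Option σ → Option σ → ℝ≥0∞}

theorem IsForestAlignment.aligns_closing (hA : A.IsForestAlignment) {o c o' c' : ℕ}
    (h : IsNode F o c) (h' : IsNode G o' c') (ho : A.Aligns o o') : A.Aligns c c' := by
  rcases hA o c h with hd | ⟨o₁, c₁, h₁, ho₁, hc₁⟩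
  · exact absurd ho (not_aligns_of_deletes hd.1)
  · obtain rfl := ho.right_unique ho₁
    rwa [h'.closing_unique h₁]

theorem IsForestAlignment.aligns_opening (hA : A.IsForestAlignment) {o c o' c' : ℕ}
    (h : IsNode F o c) (h' : IsNode G o' c') (hc : A.Aligns c c') : A.Aligns o o' := by
  rcases hA o c h with hd | ⟨o₁, c₁, h₁, ho₁, hc₁⟩
  · exact absurd hc (not_aligns_of_deletes hd.2)
  · obtain rfl := hc.right_unique hc₁
    rwa [h'.opening_unique h₁]

/-- The weight sees only labels, so aligning an opening to a closing parenthesis of equal label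
would be free. Consistency with the nodes rules this out: openings are aligned to openings, closings
to closings. -/
theorem one_le_stepCost (hF : IsForest F) (hA : A.IsForestAlignment) (hw : IsNormalized w) {t : ℕ}
    (ht : t < A.m) (he : A.IsEdit t) : 1 ≤ A.stepCost (parenWeight w) t := by
  have hb := A.bounds.2 (t + 1) ht
  unfold stepCost
  rcases A.step t ht with h | h | h
  · rw [if_neg (by omega), if_neg (by omega)]
    have hal : A.Aligns (A.x t) (A.y t) := ⟨t, ht, rfl, rfl, h.1, h.2⟩
    have hne : F[A.x t]? ≠ G[A.y t]? := fun h' => he ⟨h.1, h.2, h'⟩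
    apply hw
    intro hlab
    rcases hF.exists_isNode (i := A.x t) (by omega) with ⟨c, hc⟩ | ⟨o, ho⟩
    · rcases hA _ _ hc with hd | ⟨o₁, c₁, h₁, ho₁, -⟩
      · exact not_aligns_of_deletes hd.1 hal
      · obtain rfl := hal.right_unique ho₁
        obtain ⟨-, ⟨a, ha, -⟩, -⟩ := hc
        obtain ⟨-, ⟨b, hb, -⟩, -⟩ := h₁
        rw [ha, hb] at hlab hne
        simp only [Option.map_some, Paren.label, Option.some.injEq] at hlab
        exact hne (by rw [hlab])
    · rcases hA _ _ ho with hd | ⟨o₁, c₁, h₁, -, hc₁⟩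
      · exact not_aligns_of_deletes hd.2 hal
      · obtain rfl := hal.right_unique hc₁
        obtain ⟨-, ⟨a, -, ha⟩, -⟩ := ho
        obtain ⟨-, ⟨b, -, hb⟩, -⟩ := h₁
        rw [ha, hb] at hlab hne
        simp only [Option.map_some, Paren.label, Option.some.injEq] at hlab
        exact hne (by rw [hlab])
  · rw [if_pos h.2, List.getElem?_eq_getElem (by omega)]
    exact hw _ _ (by simp)
  · rw [if_neg (by omega), if_pos h.1, List.getElem?_eq_getElem (show A.y t < G.length by omega)]
    exact hw _ _ (by simp)

open Classical in
theorem card_isEdit_le (hF : IsForest F) (hA : A.IsForestAlignment) (hw : IsNormalized w) {n : ℕ}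
    (hcost : A.cost (parenWeight w) ≤ n) : ((Finset.range A.m).filter A.IsEdit).card ≤ n := by
  have h1 : (((Finset.range A.m).filter A.IsEdit).card : ℝ≥0∞) ≤ A.cost (parenWeight w) := by
    calc (((Finset.range A.m).filter A.IsEdit).card : ℝ≥0∞)
        = ∑ t ∈ (Finset.range A.m).filter A.IsEdit, 1 := by simp
      _ ≤ ∑ t ∈ (Finset.range A.m).filter A.IsEdit, A.stepCost (parenWeight w) t := by
          refine Finset.sum_le_sum fun t ht => ?_
          rw [Finset.mem_filter, Finset.mem_range] at ht
          exact one_le_stepCost hF hA hw ht.1 ht.2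
      _ ≤ A.cost (parenWeight w) := Finset.sum_le_sum_of_subset (Finset.filter_subset _ _)
  exact_mod_cast h1.trans hcost

/-! ### Meeting the diagonal of the common fragment -/

variable {U P V U' V' : List (Paren σ)}

/-- A path with points on both sides of a diagonal meets this diagonal. -/
theorem exists_mem_diagonal {X Y : List σ} (A : Alignment X Y) {u u' n t t' : ℕ} (ht : t ≤ A.m)
    (ht' : t' ≤ A.m) (h2 : u' ≤ A.y t ∧ A.y t ≤ u' + n)
    (h1' : u ≤ A.x t' ∧ A.x t' ≤ u + n) (hle : A.x t + u' ≤ A.y t + u)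
    (hle' : A.y t' + u ≤ A.x t' + u') :
    ∃ s ≤ A.m, ∃ i ≤ n, A.x s = u + i ∧ A.y s = u' + i := by
  have key : ∀ s ≤ A.m, min t t' ≤ s → s ≤ max t t' → A.x s + u' = A.y s + u →
      ∃ s ≤ A.m, ∃ i ≤ n, A.x s = u + i ∧ A.y s = u' + i := by
    intro s hs hs1 hs2 h
    have h3 := A.mono hs1 hs
    have h4 := A.mono hs2 (max_le ht ht')
    refine ⟨s, hs, A.x s - u, ?_⟩
    rcases le_total t t' with h5 | h5
    · rw [min_eq_left h5] at h3
      rw [max_eq_right h5] at h4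
      omega
    · rw [min_eq_right h5] at h3
      rw [max_eq_left h5] at h4
      omega
  rcases le_total t t' with h | h
  · obtain ⟨s, hs1, hs2, hs⟩ := exists_eq_zero_of_unit_steps
      (e := fun s => ((A.x s + u' : ℕ) : ℤ) - ((A.y s + u : ℕ) : ℤ)) h
      (fun s _ hs => by
        have := A.step s (by omega)
        rw [abs_le]
        push_cast
        omega) (by omega) (by omega)
    exact key s (by omega) (by omega) (by omega) (by omega)
  · obtain ⟨s, hs1, hs2, hs⟩ := exists_eq_zero_of_unit_steps
      (e := fun s => ((A.y s + u : ℕ) : ℤ) - ((A.x s + u' : ℕ) : ℤ)) h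
      (fun s _ hs => by
        have := A.step s (by omega)
        rw [abs_le]
        push_cast
        omega) (by omega) (by omega)
    exact key s (by omega) (by omega) (by omega) (by omega)

/-- A cheap forest alignment of two forests that contain `P` at nearby positions aligns some prefix
of one forest that ends in `P` to the prefix of the other forest that ends at the same position
of `P`. -/
theorem IsForestAlignment.exists_diagonal_point {k : ℕ} (hk : 0 < k) (hP : IsForest P)
    (hlen : 74 * k ^ 3 ≤ P.length) (havoid : AvoidsHorizontalPeriodicity k P)
    (hw : IsNormalized w) (hF : IsForest (U ++ P ++ V))
    (hU : |(U.length : ℤ) - U'.length| ≤ 2 * k) {A : Alignment (U ++ P ++ V) (U' ++ P ++ V')}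
    (hA : A.IsForestAlignment) (hcost : A.cost (parenWeight w) ≤ (2 * k : ℕ)) :
    ∃ t ≤ A.m, ∃ i ≤ P.length, A.x t = U.length + i ∧ A.y t = U'.length + i := by
  classical
  have hcard := card_isEdit_le hF hA hw hcost
  have hdrift := fun {t} (ht : t ≤ A.m) => abs_le.mp (A.abs_x_sub_y_le hcard ht)
  rw [abs_le] at hU
  push_cast at hdrift
  have hXlen : (U ++ P ++ V).length = U.length + P.length + V.length := by simp; ring
  -- Room for `2k + 1` blocks of length `20k²`, one more than the number of edits, and for margins
  -- of `4k` at both ends. The block length exceeds `4k + 1` periods of length at most `4k`, or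
  -- equals them.
  have hlong : (2 * k + 1) * (20 * k ^ 2) + 8 * k ≤ P.length := by
    refine le_trans ?_ hlen
    obtain ⟨n, rfl⟩ : ∃ n, k = n + 1 := ⟨k - 1, by omega⟩
    ring_nf
    nlinarith [Nat.zero_le n]
  have hLpos : (4 * k + 1) * (4 * k) ≤ 20 * k ^ 2 := by nlinarith
  set L := 20 * k ^ 2 with hL
  have hL0 : 0 < L := by positivity
  have hLL : L ≤ (2 * k + 1) * L := Nat.le_mul_of_pos_left _ (by omega)
  obtain ⟨t₀, ht₀, hx₀⟩ := A.exists_x_eq (i := U.length + 4 * k) (by omega)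
  obtain ⟨t₁, ht₁, hx₁⟩ := A.exists_x_eq (i := U.length + (P.length - 4 * k)) (by omega)
  have hlt : t₀ < t₁ := by
    by_contra h
    have := A.mono (Nat.le_of_not_lt h) ht₀
    omega
  have hdist : ∀ t, t₀ ≤ t → t ≤ A.m → A.x t ≤ A.x t₀ + (t - t₀) := by
    intro t h
    induction t, h using Nat.le_induction with
    | base => intro _; omega
    | succ t h ih =>
      intro ht
      have h1 := ih (by omega)
      have h2 := A.step t ht
      omega
  have hd := hdist t₁ hlt.le ht₁
  obtain ⟨t, ht, htL, hrun⟩ := exists_run (a := t₀) (b := t₁) (L := L) hcard (by omega) ht₁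
  -- The margin `4k` absorbs the drift `2k` of the path and the offset `2k` between the two
  -- occurrences. The same sum bounds the period `|i - j|` below.
  have hsq : ∀ s, t₀ ≤ s → s ≤ t₁ → U.length ≤ A.x s ∧ A.x s ≤ U.length + P.length ∧
      U'.length ≤ A.y s ∧ A.y s ≤ U'.length + P.length := by
    intro s h1 h2
    have h3 := A.mono h1 (h2.trans ht₁)
    have h4 := A.mono h2 ht₁
    have h5 := hdrift (t := s) (by omega)
    omega
  have hxy : ∀ r ≤ L, A.x (t + r) = A.x t + r ∧ A.y (t + r) = A.y t + r := by
    intro r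
    induction r with
    | zero => intro _; exact ⟨rfl, rfl⟩
    | succ r ih =>
      intro hr
      have h1 := ih (by omega)
      have h2 := hrun r hr
      rw [IsEdit, not_not] at h2
      rw [← add_assoc]
      omega
  have hal : ∀ r < L, A.Aligns (A.x t + r) (A.y t + r) := by
    intro r hr
    have h1 := hxy r hr.le
    have h2 := hxy (r + 1) hr
    exact ⟨t + r, by omega, h1.1, h1.2, by rw [add_assoc, h2.1]; omega,
      by rw [add_assoc, h2.2]; omega⟩
  obtain ⟨i, hi⟩ := Nat.exists_eq_add_of_le (hsq t ht (by omega)).1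
  obtain ⟨j, hj⟩ := Nat.exists_eq_add_of_le (hsq t ht (by omega)).2.2.1
  have hsqL := hsq (t + L) (by omega) htL
  rw [(hxy L le_rfl).1, (hxy L le_rfl).2] at hsqL
  have heq : ∀ r < L, P[i + r]? = P[j + r]? := by
    intro r hr
    have h1 := hxy r hr.le
    have h2 := hrun r hr
    rw [IsEdit, not_not] at h2
    have h3 := h2.2.2
    rwa [h1.1, h1.2, hi, hj, add_assoc, add_assoc, getElem?_append_middle _ _ _ (by omega),
      getElem?_append_middle _ _ _ (by omega)] at h3
  -- Two aligned pairs inside the square on opposite sides of the diagonal suffice.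
  have hcross : ∀ a b a' b', a < P.length → b < P.length → a' < P.length → b' < P.length →
      A.Aligns (U.length + a) (U'.length + b) → A.Aligns (U.length + a') (U'.length + b') →
      a ≤ b → b' ≤ a' →
      ∃ t ≤ A.m, ∃ i ≤ P.length, A.x t = U.length + i ∧ A.y t = U'.length + i := by
    rintro a b a' b' ha hb ha' hb' ⟨s, hs, h1, h2, -⟩ ⟨s', hs', h1', h2', -⟩ hab hab'
    apply exists_mem_diagonal (A := A) hs.le hs'.le <;> omega
  have hdt := hdrift (t := t) (by omega)
  have htrans : ∀ o c, IsNode P o c →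
      IsNode (U ++ P ++ V) (U.length + o) (U.length + c) ∧
      IsNode (U' ++ P ++ V') (U'.length + o) (U'.length + c) := fun o c h =>
    ⟨(isNode_append_middle h.lt_length).mpr h, (isNode_append_middle h.lt_length).mpr h⟩
  have hsL : ∀ s, s ≤ 4 * k → (4 * k + 1) * s ≤ L := fun s hs =>
    (Nat.mul_le_mul_left _ hs).trans hLpos
  -- Off the diagonal, the run aligns two parentheses of nested nodes; consistency aligns their
  -- mates, which nesting places on the other side.
  rcases lt_trichotomy i j with hij | rfl | hij
  · obtain ⟨s, rfl⟩ := Nat.exists_eq_add_of_le hij.le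
    obtain ⟨r, hr, c, c', hcc, ⟨h1, h2⟩ | ⟨h1, h2⟩⟩ := exists_nested_nodes_of_periodic hP havoid
      (b := i) (s := s) (L := L) (by omega) (by omega) (hsL s (by omega)) (by omega)
      fun r hr => (heq r hr).symm
    all_goals
      have h3 := hal r hr
      rw [hi, hj, add_assoc, add_assoc U'.length] at h3
      have := h1.lt_length
      have := h2.lt_length
      have := h1.1
      have := h2.1
    · exact hcross (i + r) (i + s + r) c' c (by omega) (by omega) (by omega) (by omega) h3
        (hA.aligns_closing (htrans _ _ h2).1 (htrans _ _ h1).2 h3) (by omega) hcc.le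
    · exact hcross (i + r) (i + s + r) c' c (by omega) (by omega) (by omega) (by omega) h3
        (hA.aligns_opening (htrans _ _ h2).1 (htrans _ _ h1).2 h3) (by omega) hcc.le
  · exact ⟨t, by omega, i, by omega, hi, hj⟩
  · obtain ⟨s, rfl⟩ := Nat.exists_eq_add_of_le hij.le
    obtain ⟨r, hr, c, c', hcc, ⟨h1, h2⟩ | ⟨h1, h2⟩⟩ := exists_nested_nodes_of_periodic hP havoid
      (b := j) (s := s) (L := L) (by omega) (by omega) (hsL s (by omega)) (by omega) heq
    all_goals
      have h3 := hal r hr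
      rw [hi, hj, add_assoc, add_assoc U'.length] at h3
      have := h1.lt_length
      have := h2.lt_length
      have := h1.1
      have := h2.1
    · exact hcross c c' (j + s + r) (j + r) (by omega) (by omega) (by omega) (by omega)
        (hA.aligns_closing (htrans _ _ h1).1 (htrans _ _ h2).2 h3) h3 hcc.le (by omega)
    · exact hcross c c' (j + s + r) (j + r) (by omega) (by omega) (by omega) (by omega)
        (hA.aligns_opening (htrans _ _ h1).1 (htrans _ _ h2).2 h3) h3 hcc.le (by omega)

end

end Alignment

/-! Replacing a common subforest -/

/-- The positions below `N` outside of `[u + l .. u + r)`. -/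
def outside (N u l r : ℕ) : Finset ℕ := (Finset.range N).filter fun i => i < u + l ∨ u + r ≤ i

theorem mem_outside {N u l r i : ℕ} : i ∈ outside N u l r ↔ i < N ∧ (i < u + l ∨ u + r ≤ i) := by
  simp [outside]

theorem outside_self (N u l : ℕ) : outside N u l l = Finset.range N := by
  ext i
  rw [mem_outside, Finset.mem_range]
  omega

theorem insert_outside_left {N u l r : ℕ} (hN : u + l < N) :
    insert (u + l) (outside N u l r) = outside N u (l + 1) r := by
  ext i
  rw [Finset.mem_insert, mem_outside, mem_outside]
  omega

theorem insert_outside_right {N u l r : ℕ} (hN : u + r < N) :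
    insert (u + r) (outside N u l (r + 1)) = outside N u l r := by
  ext i
  rw [Finset.mem_insert, mem_outside, mem_outside]
  omega

theorem shiftPos_lt_shiftPos_iff {u n n' i j : ℕ} (hi : i < u ∨ u + n ≤ i)
    (hj : j < u ∨ u + n ≤ j) : shiftPos u n n' i < shiftPos u n n' j ↔ i < j := by
  unfold shiftPos
  split_ifs <;> omega

theorem shiftPos_lt_iff {u n n' i q : ℕ} (hi : i < u ∨ u + n ≤ i) (hq : q < n') :
    shiftPos u n n' i < u + q ↔ i < u := by
  unfold shiftPos
  split_ifs <;> omega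

theorem shiftPos_outside {u n n' i : ℕ} (hi : i < u ∨ u + n ≤ i) :
    shiftPos u n n' i < u ∨ u + n' ≤ shiftPos u n n' i := by
  unfold shiftPos
  split_ifs <;> omega

theorem shiftPos_shiftPos {u n n' i : ℕ} (hi : i < u ∨ u + n ≤ i) :
    shiftPos u n' n (shiftPos u n n' i) = i := by
  unfold shiftPos
  split_ifs <;> omega

theorem shiftPos_lt_length {α : Type*} {X Y Y' Z : List α} {i : ℕ}
    (hi : i < X.length ∨ X.length + Y.length ≤ i) (h : i < (X ++ Y ++ Z).length) :
    shiftPos X.length Y.length Y'.length i < (X ++ Y' ++ Z).length := by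
  simp only [List.length_append] at h ⊢
  unfold shiftPos
  split_ifs <;> omega

theorem image_shiftPos_outside {α : Type*} (X Y Y' Z : List α) :
    (outside (X ++ Y ++ Z).length X.length 0 Y.length).image
      (shiftPos X.length Y.length Y'.length) =
    outside (X ++ Y' ++ Z).length X.length 0 Y'.length := by
  ext i
  rw [Finset.mem_image]
  constructor
  · rintro ⟨j, hj, rfl⟩
    rw [mem_outside] at hj ⊢
    exact ⟨shiftPos_lt_length hj.2 hj.1, shiftPos_outside hj.2⟩
  · intro hi
    rw [mem_outside] at hi
    exact ⟨shiftPos X.length Y'.length Y.length i,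
      mem_outside.mpr ⟨shiftPos_lt_length hi.2 hi.1, shiftPos_outside hi.2⟩,
      shiftPos_shiftPos hi.2⟩

section Replacement

variable {σ : Type*} {w : Option σ → Option σ → ℝ≥0∞} {P P' U V U' V' : List (Paren σ)}

theorem getElem?_append_middle_eq {α : Type*} (X Y Z X' Z' : List α) {q : ℕ} (hq : q < Y.length) :
    (X ++ Y ++ Z)[X.length + q]? = (X' ++ Y ++ Z')[X'.length + q]? := by
  rw [getElem?_append_middle _ _ _ hq, getElem?_append_middle _ _ _ hq]

/-- Restricting an alignment to the positions outside of a common fragment does not increase the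
cost if the alignment respects some position of this fragment. -/
theorem Alignment.matchingCost_outside_le {α : Type*} {v : Option α → Option α → ℝ≥0∞}
    (tri : ∀ a b c, v a c ≤ v a b + v b c) {X Y Z X' Z' : List α}
    (A : Alignment (X ++ Y ++ Z) (X' ++ Y ++ Z')) {d : ℕ} (hd : d ≤ Y.length)
    (hsplit : ∀ i j, A.Aligns i j → (i < X.length + d ↔ j < X'.length + d)) :
    matchingCost v (fun i => (X ++ Y ++ Z)[i]?) (fun j => (X' ++ Y ++ Z')[j]?) A.Aligns
      (outside (X ++ Y ++ Z).length X.length 0 Y.length)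
      (outside (X' ++ Y ++ Z').length X'.length 0 Y.length) ≤ A.cost v := by
  have hX : (X ++ Y ++ Z).length = X.length + Y.length + Z.length := by simp; ring
  have hX' : (X' ++ Y ++ Z').length = X'.length + Y.length + Z'.length := by simp; ring
  set C : ℕ → ℕ → ℝ≥0∞ := fun l r =>
    matchingCost v (fun i => (X ++ Y ++ Z)[i]?) (fun j => (X' ++ Y ++ Z')[j]?) A.Aligns
      (outside (X ++ Y ++ Z).length X.length l r)
      (outside (X' ++ Y ++ Z').length X'.length l r) with hC
  -- Peeling from the cut `d` outwards: the remaining positions on the same side of the cut all lie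
  -- beyond the removed pair, so if both its members were matched elsewhere, these two matches would
  -- cross.
  have hleft : ∀ e ≤ d, C (d - e) d ≤ C d d := by
    intro e
    induction e with
    | zero => intro _; exact le_rfl
    | succ e ih =>
      intro he
      refine le_trans ?_ (ih (by omega))
      obtain ⟨l, hl⟩ : ∃ l, l = d - (e + 1) := ⟨_, rfl⟩
      rw [← hl, show d - e = l + 1 by omega, hC]
      simp only
      rw [← insert_outside_left (l := l) (N := (X ++ Y ++ Z).length) (by omega),
        ← insert_outside_left (l := l) (N := (X' ++ Y ++ Z').length) (by omega)]
      refine matchingCost_le_insert tri (fun _ _ _ h h' => h.right_unique h')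
        (fun _ _ _ h h' => h.left_unique h') (by rw [mem_outside]; omega)
        (by rw [mem_outside]; omega) (getElem?_append_middle_eq _ _ _ _ _ (by omega)) ?_
      intro i hi j hj h h'
      rw [mem_outside] at hi hj
      have h1 := hsplit _ _ h
      have h2 := hsplit _ _ h'
      have h3 := h.lt_iff_lt h'
      omega
  have hright : ∀ r, d ≤ r → r ≤ Y.length → C 0 r ≤ C 0 d := by
    intro r hr
    induction r, hr using Nat.le_induction with
    | base => intro _; exact le_rfl
    | succ r hr ih =>
      intro hrY
      refine le_trans ?_ (ih (by omega))
      rw [hC]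
      simp only
      rw [← insert_outside_right (l := 0) (r := r) (N := (X ++ Y ++ Z).length) (by omega),
        ← insert_outside_right (l := 0) (r := r) (N := (X' ++ Y ++ Z').length) (by omega)]
      refine matchingCost_le_insert tri (fun _ _ _ h h' => h.right_unique h')
        (fun _ _ _ h h' => h.left_unique h') (by rw [mem_outside]; omega)
        (by rw [mem_outside]; omega) (getElem?_append_middle_eq _ _ _ _ _ (by omega)) ?_
      intro i hi j hj h h'
      rw [mem_outside] at hi hj
      have h1 := hsplit _ _ h
      have h2 := hsplit _ _ h'
      have h3 := h'.lt_iff_lt h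
      omega
  have h1 := hleft d le_rfl
  rw [Nat.sub_self] at h1
  have h2 : C d d = A.cost v := by
    rw [A.cost_eq_matchingCost, hC]
    simp only [outside_self]
  exact (hright _ hd le_rfl).trans (h1.trans h2.le)

/-- An alignment that is the identity on a common fragment only pays for the other positions. -/
theorem Alignment.cost_eq_matchingCost_outside {α : Type*} {v : Option α → Option α → ℝ≥0∞}
    (hv : ∀ a, v a a = 0) {X Y Z X' Z' : List α}
    (A : Alignment (X ++ Y ++ Z) (X' ++ Y ++ Z'))
    (hid : ∀ q < Y.length, A.Aligns (X.length + q) (X'.length + q)) :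
    A.cost v =
      matchingCost v (fun i => (X ++ Y ++ Z)[i]?) (fun j => (X' ++ Y ++ Z')[j]?) A.Aligns
        (outside (X ++ Y ++ Z).length X.length 0 Y.length)
        (outside (X' ++ Y ++ Z').length X'.length 0 Y.length) := by
  have hX : (X ++ Y ++ Z).length = X.length + Y.length + Z.length := by simp; ring
  have hX' : (X' ++ Y ++ Z').length = X'.length + Y.length + Z'.length := by simp; ring
  have key : ∀ l ≤ Y.length,
      matchingCost v (fun i => (X ++ Y ++ Z)[i]?) (fun j => (X' ++ Y ++ Z')[j]?) A.Aligns
        (outside (X ++ Y ++ Z).length X.length l Y.length)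
        (outside (X' ++ Y ++ Z').length X'.length l Y.length) =
      matchingCost v (fun i => (X ++ Y ++ Z)[i]?) (fun j => (X' ++ Y ++ Z')[j]?) A.Aligns
        (outside (X ++ Y ++ Z).length X.length 0 Y.length)
        (outside (X' ++ Y ++ Z').length X'.length 0 Y.length) := by
    intro l
    induction l with
    | zero => intro _; rfl
    | succ l ih =>
      intro hl
      have hal := hid l hl
      rw [← ih (by omega), ← insert_outside_left (l := l) (by omega),
        ← insert_outside_left (l := l) (by omega),
        matchingCost_insert_match (by rw [mem_outside]; omega) (by rw [mem_outside]; omega) hal,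
        getElem?_append_middle_eq X Y Z X' Z' hl, hv, zero_add]
      · intro j hj h
        have := hal.right_unique h
        rw [mem_outside] at hj
        omega
      · intro i hi h
        have := hal.left_unique h
        rw [mem_outside] at hi
        omega
  rw [A.cost_eq_matchingCost, ← key _ le_rfl, outside_self, outside_self]

/-- A forest alignment of `U ++ P ++ V` onto `U' ++ P ++ V'` that respects some position of the
common fragment `P` gives rise to a forest alignment for any other forest in place of `P`. -/
theorem Alignment.IsForestAlignment.exists_replace (hw : IsQuasimetric w) (hP : IsForest P)
    (hP' : IsForest P') {A : Alignment (U ++ P ++ V) (U' ++ P ++ V')}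
    (hA : A.IsForestAlignment) {d : ℕ} (hd : d ≤ P.length)
    (hsplit : ∀ i j, A.Aligns i j → (i < U.length + d ↔ j < U'.length + d)) :
    ∃ B : Alignment (U ++ P' ++ V) (U' ++ P' ++ V'), B.IsForestAlignment ∧
      B.cost (parenWeight w) ≤ A.cost (parenWeight w) := by
  set n := P.length with hn
  set n' := P'.length with hn'
  set u := U.length with hu
  set u' := U'.length with hu'
  -- The pairs of `A` with both ends outside `P`, together with the identity on `P'`. Pairs with
  -- just one end in `P` are dropped, leaving the other end unmatched.
  let M : ℕ → ℕ → Prop := fun i j =>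
    (∃ a b, (a < u ∨ u + n ≤ a) ∧ (b < u' ∨ u' + n ≤ b) ∧ A.Aligns a b ∧
      i = shiftPos u n n' a ∧ j = shiftPos u' n n' b) ∨ ∃ q < n', i = u + q ∧ j = u' + q
  have hlenF' : (U ++ P' ++ V).length = u + n' + V.length := by simp; omega
  have hlenG' : (U' ++ P' ++ V').length = u' + n' + V'.length := by simp; omega
  obtain ⟨B, hB⟩ : ∃ B : Alignment (U ++ P' ++ V) (U' ++ P' ++ V'),
      ∀ i j, B.Aligns i j ↔ M i j := by
    apply Alignment.exists_aligns_iff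
    · rintro i j (⟨a, b, ha, hb, hab, rfl, rfl⟩ | ⟨q, hq, rfl, rfl⟩)
      · have := hab.lt_length
        exact ⟨shiftPos_lt_length ha this.1, shiftPos_lt_length hb this.2⟩
      · omega
    · rintro i j i₁ j₁ (⟨a, b, ha, hb, hab, rfl, rfl⟩ | ⟨q, hq, rfl, rfl⟩)
        (⟨a₁, b₁, ha₁, hb₁, hab₁, rfl, rfl⟩ | ⟨q₁, hq₁, rfl, rfl⟩)
      · rw [shiftPos_lt_shiftPos_iff ha ha₁, shiftPos_lt_shiftPos_iff hb hb₁]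
        exact hab.lt_iff_lt hab₁
      -- The cut inside `P` forces an outside pair to lie entirely before or entirely after the new
      -- fragment.
      · rw [shiftPos_lt_iff ha hq₁, shiftPos_lt_iff hb hq₁]
        have := hsplit _ _ hab
        omega
      · have h1 := shiftPos_lt_iff ha₁ hq
        have h2 := shiftPos_lt_iff hb₁ hq
        have h3 := shiftPos_outside (n' := n') ha₁
        have h4 := shiftPos_outside (n' := n') hb₁
        have := hsplit _ _ hab₁
        omega
      · omega
  have hBdel : ∀ i, i < (U ++ P ++ V).length → (i < u ∨ u + n ≤ i) →
      (∀ j, A.Aligns i j → ¬ (j < u' ∨ u' + n ≤ j)) → B.Deletes (shiftPos u n n' i) := by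
    intro i hi hi' h
    have hlt : shiftPos u n n' i < (U ++ P' ++ V).length := shiftPos_lt_length hi' hi
    rw [B.deletes_iff hlt]
    intro j hj
    rcases (hB _ _).mp hj with ⟨a, b, ha, hb, hab, h1, -⟩ | ⟨q, hq, h1, -⟩
    · have h2 := shiftPos_lt_shiftPos_iff (n' := n') hi' ha
      have h3 := shiftPos_lt_shiftPos_iff (n' := n') ha hi'
      obtain rfl : i = a := by omega
      exact h _ hab hb
    · have := shiftPos_outside (n' := n') hi'
      omega
  refine ⟨B, ?_, ?_⟩
  · intro o c h
    have hmem := h.mem_middle_iff hP'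
    by_cases ho : u ≤ o ∧ o < u + n'
    · obtain ⟨o, rfl⟩ := Nat.exists_eq_add_of_le ho.1
      obtain ⟨c, rfl⟩ := Nat.exists_eq_add_of_le (hmem.mp ho).1
      have hc : c < n' := by omega
      have h1 := (isNode_append_middle hc).mp h
      exact Or.inr ⟨u' + o, u' + c, (isNode_append_middle hc).mpr h1,
        (hB _ _).mpr (Or.inr ⟨o, by omega, rfl, rfl⟩), (hB _ _).mpr (Or.inr ⟨c, hc, rfl, rfl⟩)⟩
    · have ho' : o < u ∨ u + n' ≤ o := by omega
      have hc' : c < u ∨ u + n' ≤ c := by omega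
      have h1 := h.shiftPos hP' hP ho'
      obtain ⟨o₀, ho₀, hoo, rfl⟩ : ∃ o₀, (o₀ < u ∨ u + n ≤ o₀) ∧
          shiftPos u n' n o = o₀ ∧ o = shiftPos u n n' o₀ :=
        ⟨_, shiftPos_outside ho', rfl, (shiftPos_shiftPos ho').symm⟩
      obtain ⟨c₀, hc₀, hcc, rfl⟩ : ∃ c₀, (c₀ < u ∨ u + n ≤ c₀) ∧
          shiftPos u n' n c = c₀ ∧ c = shiftPos u n n' c₀ :=
        ⟨_, shiftPos_outside hc', rfl, (shiftPos_shiftPos hc').symm⟩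
      rw [hoo, hcc] at h1
      have hcl := h1.lt_length
      have hol := h1.1.trans hcl
      rcases hA _ _ h1 with ⟨hdo, hdc⟩ | ⟨o₁, c₁, h₁, ho₁, hc₁⟩
      · exact Or.inl ⟨hBdel _ hol ho₀ fun j hj => absurd hj (not_aligns_of_deletes hdo),
          hBdel _ hcl hc₀ fun j hj => absurd hj (not_aligns_of_deletes hdc)⟩
      · have hmem₁ := h₁.mem_middle_iff hP
        -- A node whose partner lies in the removed copy of `P` loses both matches at once, because
        -- the partner lies there with both of its ends; hence the node is deleted consistently.
        by_cases hoP : u' ≤ o₁ ∧ o₁ < u' + n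
        · refine Or.inl ⟨hBdel _ hol ho₀ fun j hj => ?_, hBdel _ hcl hc₀ fun j hj => ?_⟩
          · obtain rfl := ho₁.right_unique hj
            omega
          · obtain rfl := hc₁.right_unique hj
            omega
        · exact Or.inr ⟨_, _, h₁.shiftPos hP hP' (by omega),
            (hB _ _).mpr (Or.inl ⟨o₀, o₁, ho₀, by omega, ho₁, rfl, rfl⟩),
            (hB _ _).mpr (Or.inl ⟨c₀, c₁, hc₀, by omega, hc₁, rfl, rfl⟩)⟩
  · have htri : ∀ a b c, parenWeight w a c ≤ parenWeight w a b + parenWeight w b c :=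
      fun _ _ _ => hw.triangle _ _ _
    have hself : ∀ a, parenWeight w a a = 0 := fun _ => hw.self_eq_zero _
    -- The identity on `P'` is free, and outside the fragments `B` is a relabelling of `A`.
    refine le_of_eq_of_le ?_ (A.matchingCost_outside_le htri hd hsplit)
    rw [B.cost_eq_matchingCost_outside hself
      (fun q hq => (hB _ _).mpr (Or.inr ⟨q, hq, rfl, rfl⟩)), ← image_shiftPos_outside U P P' V,
      ← image_shiftPos_outside U' P P' V']
    have hinj : ∀ N u, Set.InjOn (shiftPos u n n') (outside N u 0 n) := by
      intro N u i hi j hj hij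
      rw [Finset.mem_coe, mem_outside, add_zero] at hi hj
      have h1 := shiftPos_lt_shiftPos_iff (n' := n') hi.2 hj.2
      have h2 := shiftPos_lt_shiftPos_iff (n' := n') hj.2 hi.2
      omega
    refine matchingCost_map (hinj _ _) (hinj _ _)
      (fun i hi => getElem?_shiftPos _ _ _ _ (mem_outside.mp hi).2)
      (fun i hi => getElem?_shiftPos _ _ _ _ (mem_outside.mp hi).2) ?_
    intro i hi j hj
    have hi : i < u ∨ u + n ≤ i := (mem_outside.mp hi).2
    have hj : j < u' ∨ u' + n ≤ j := (mem_outside.mp hj).2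
    rw [← hu, ← hu', ← hn, ← hn', hB]
    constructor
    · rintro (⟨a, b, ha, hb, hab, h1, h2⟩ | ⟨q, hq, h1, h2⟩)
      · have h3 := shiftPos_shiftPos (n' := n') hi
        rw [h1, shiftPos_shiftPos ha] at h3
        have h4 := shiftPos_shiftPos (n' := n') hj
        rw [h2, shiftPos_shiftPos hb] at h4
        rwa [← h3, ← h4]
      · have := shiftPos_outside (n' := n') hi
        omega
    · exact fun h => Or.inl ⟨i, j, hi, hj, h, rfl, rfl⟩

/-- Length and periodicity matter only for the forest being removed; the one put in its place is an
arbitrary forest. -/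
theorem ted_replace_le {k : ℕ} (hk : 0 < k) (hP : IsForest P) (hP' : IsForest P')
    (hlen : 74 * k ^ 3 ≤ P.length) (havoid : AvoidsHorizontalPeriodicity k P)
    (hw : IsQuasimetric w) (hnorm : IsNormalized w) (hF : IsForest (U ++ P ++ V))
    (hU : |(U.length : ℤ) - U'.length| ≤ 2 * k)
    (hted : ted w (U ++ P ++ V) (U' ++ P ++ V') ≤ k) :
    ted w (U ++ P' ++ V) (U' ++ P' ++ V') ≤ ted w (U ++ P ++ V) (U' ++ P ++ V') := by
  obtain ⟨A, hA, hcost⟩ := exists_tedCost_eq_ted w (U ++ P ++ V) (U' ++ P ++ V')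
  rw [← hcost] at hted ⊢
  have hle : A.cost (parenWeight w) ≤ (2 * k : ℕ) := by
    unfold tedCost at hted
    rw [ENNReal.div_le_iff (by simp) (by simp)] at hted
    push_cast
    rwa [mul_comm]
  obtain ⟨t, ht, d, hd, hx, hy⟩ :=
    hA.exists_diagonal_point hk hP hlen havoid hnorm hF hU hle
  obtain ⟨B, hB, hBA⟩ := hA.exists_replace hw hP hP' hd fun i j h => by
    rw [← hx, ← hy]
    exact h.lt_iff ht
  refine (iInf_le _ ⟨B, hB⟩).trans ?_
  unfold tedCost
  exact ENNReal.div_le_div_right hBA 2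

end Replacement

/-! ### From occurrences to concatenations, and the theorem -/

theorem OccursAt.exists_eq_append {α : Type*} {P X : List α} {p : ℕ} (h : OccursAt P X p) :
    ∃ U V, X = U ++ P ++ V ∧ U.length = p := by
  refine ⟨X.take p, X.drop (p + P.length), ?_, ?_⟩
  · conv_lhs => rw [← List.take_append_drop (p + P.length) X,
      ← take_append_frag X (Nat.le_add_right p P.length), h.2]
  · rw [List.length_take]
    have := h.1
    omega

theorem replaceFrag_append {α : Type*} (U P V P' : List α) :
    replaceFrag (U ++ P ++ V) U.length P.length P' = U ++ P' ++ V := by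
  unfold replaceFrag frag
  rw [← List.length_append, List.drop_left, List.take_of_length_le (l := V) (by simp; omega)]
  simp

end TreeEdit

theorem mainTheorem9 {σ : Type*} (k : ℕ) (hk : 0 < k) (P P' : List (TreeEdit.Paren σ))
    (hP : TreeEdit.IsForest P) (hP' : TreeEdit.IsForest P')
    (hlen : 74 * k ^ 3 ≤ P.length) (hlen' : 74 * k ^ 3 ≤ P'.length)
    (havoid : TreeEdit.AvoidsHorizontalPeriodicity k P)
    (havoid' : TreeEdit.AvoidsHorizontalPeriodicity k P')
    (w : Option σ → Option σ → ℝ≥0∞)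
    (hw : TreeEdit.IsQuasimetric w) (hnorm : TreeEdit.IsNormalized w) :
    TreeEdit.TedEquivalent k w P P' := by
  intro F G pF pG hF hG hoF hoG hp
  obtain ⟨U, V, rfl, rfl⟩ := hoF.exists_eq_append
  obtain ⟨U', V', rfl, rfl⟩ := hoG.exists_eq_append
  rw [TreeEdit.replaceFrag_append, TreeEdit.replaceFrag_append]
  have h1 := TreeEdit.ted_replace_le (V' := V') hk hP hP' hlen havoid hw hnorm hF hp
  have h2 := TreeEdit.ted_replace_le (V' := V') hk hP' hP hlen' havoid' hw hnorm
    (hP.replace hP' hF) hp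
  -- Each inequality is available once its own right-hand side is at most `k`, so the two distances
  -- are within the threshold together, and then they agree.
  unfold TreeEdit.tedLE
  rw [ENNReal.coe_natCast]
  split_ifs with h3 h4 h4
  · exact le_antisymm (h2 h4) (h1 h3)
  · exact absurd ((h1 h3).trans h3) h4
  · exact absurd ((h2 h4).trans h4) h3
  · rfl
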